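/- **Setting.** Let $\mathcal D=(V,E)$ be a finite DAG with positive edge weights $c_{ki}$ for $k\to i\in E$, and let $\boldsymbol C$ be the matrix with entries $c_{ki}$ if $k\to i\in E$ and $0$ otherwise. For a path $p=[j=k_0\to k_1\to\dots\to k_n=i]$ put $d_{ji}(p)=\prod_{l=0}^{n-1}c_{k_lk_{l+1}}$, $S_p=\{k_1,\dots,k_n\}$ and $\zeta(p)=|S_p|$, and let $b_{ji}$ be the maximum of $d_{ji}(p)$ over all paths $p$ from $j$ to $i$ (with $b_{jj}=1$, and $b_{ji}=0$ if there is no path). A path $p$ from $j$ to $i$ is critical if $d_{ji}(p)=b_{ji}$. The matrix $\boldsymbol C$ is generic if for all $j,i$ there is at most one critical path from $j$ to $i$. A random vector $\boldsymbol U=(U_i)_{i\in V}$ is a recursive max-linear vector with propagating noise on $\mathcal D$ if almost surely $$U_i=\Big(\bigvee_{k:\,k\to i\in E}c_{ki}U_k\vee Z_i\Big)\varepsilon_i,\qquad i\in V,$$ where the innovations $Z_i$ are independent, positive and atom-free with support $[0,\infty)$, the noise variables $\varepsilon_i$ are iid, atom-free, at least $1$ and unbounded above, and $(\varepsilon_i)_{i\in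 V}$ is independent of $(Z_i)_{i\in V}$. A positive random variable with distribution function $F$ is regularly varying at zero with exponent $\alpha>0$ if $\lim_{t\downarrow0}F(tx)/F(t)=x^\alpha$ for all $x>0$. Let $F_Y$ denote the distribution function of $Y$, $F_Y^{\leftarrow}$ its quantile function, and $\Psi_{\kappa,s}(x)=1-\exp(-(x/s)^\kappa)$, $x>0$, the Weibull distribution function with shape $\kappa$ and scale $s$. **Theorem.** Let $\boldsymbol U$ be a recursive max-linear vector with propagating noise on $\mathcal D$. Assume that $\boldsymbol C$ is generic and that $\ln\varepsilon_i$ is regularly varying at zero with exponent $\alpha>0$. Let $R=\{(j,i)\in V\times V: j\ne i,\ b_{ji}>0\}$, and for $(j,i)\in R$ let $p_{ji}$ be the critical path from $j$ to $i$. Then there are constants $c^{(ji)}\in(0,1)$, $(j,i)\in R$, such that, for every $(j,i)\in R$, $$\mathbb P\Big(\frac{U_i}{U_j}\le b_{ji}x\Big)\sim\mathbb P\Big(\prod_{k\in S_{p_{ji}}}\varepsilon_k\le x,\ \frac{U_i}{U_j}=b_{ji}\prod_{k\in S_{p_{ji}}}\varepsilon_k\Big)\sim c^{(ji)}\,\mathbb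 P\Big(\prod_{k\in S_{p_{ji}}}\varepsilon_k\le x\Big),\qquad x\downarrow1,$$ and the following holds. If $(a^{(ji)}_n)_{n}$ are real sequences with $a_n^{(ji)}\sim F^{\leftarrow}_{\sum_{k\in S_{p_{ji}}}\ln\varepsilon_k}(1/n)$ as $n\to\infty$ for each $(j,i)\in R$, and $\boldsymbol U^1,\boldsymbol U^2,\dots$ are iid copies of $\boldsymbol U$, then for all $x_{ji}>0$, $(j,i)\in R$, $$\lim_{n\to\infty}\mathbb P\bigg(\frac1{a_n^{(ji)}b_{ji}}\Big(\bigwedge_{k=1}^n\frac{U_i^k}{U_j^k}-b_{ji}\Big)\le x_{ji}\ \ \forall (j,i)\in R\bigg)=\prod_{(j,i)\in R}\Psi_{\zeta(p_{ji})\alpha,\ (c^{(ji)})^{-1/(\zeta(p_{ji})\alpha)}}(x_{ji}).$$ -/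

import Mathlib

open MeasureTheory ProbabilityTheory Filter Topology

namespace MaxLinear

section Graph

variable {V : Type*}

/-- A directed graph is acyclic (a DAG) if no node can be reached from itself along one or
more edges. -/
def IsDAG (D : Digraph V) : Prop :=
  ∀ i, ¬ Relation.TransGen D.Adj i i

/-- `C` is an edge weight matrix of `D`: the entry `C k i` is positive if `k → i` is an edge and
zero otherwise. -/
structure IsEdgeWeightMatrix (D : Digraph V) (C : Matrix V V ℝ) : Prop where
  pos : ∀ k i, D.Adj k i → 0 < C k i
  zero : ∀ k i, ¬ D.Adj k i → C k i = 0

/-- The list `p = [k₀, k₁, …, kₙ]` is a path `j = k₀ → k₁ → ⋯ → kₙ = i` in `D`. The list `[j]` is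
the trivial path from `j` to `j`. -/
structure IsPath (D : Digraph V) (j i : V) (p : List V) : Prop where
  chain : p.IsChain D.Adj
  head : p.head? = some j
  last : p.getLast? = some i

/-- The path weight, the product of `C kₗ kₗ₊₁` over the edges of the path `[k₀, …, kₙ]`. -/
def pathWeight (C : Matrix V V ℝ) (p : List V) : ℝ :=
  ((p.zip p.tail).map fun e => C e.1 e.2).prod

/-- The max-linear coefficient `b_{ji}`: the maximum of the weights of all paths from `j` to `i`.
On a finite DAG it is `1` for `i = j` (only the trivial path) and `0` if there is no path. -/
noncomputable def mlCoeff (D : Digraph V) (C : Matrix V V ℝ) (j i : V) : ℝ :=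
  sSup {w | ∃ p, IsPath D j i p ∧ w = pathWeight C p}

/-- A (non-random) critical path from `j` to `i`: its weight is `b_{ji}`. -/
def IsCriticalPath (D : Digraph V) (C : Matrix V V ℝ) (j i : V) (p : List V) : Prop :=
  IsPath D j i p ∧ pathWeight C p = mlCoeff D C j i

/-- A generic path from `j` to `i`: it is the only critical path from `j` to `i`. -/
def IsGenericPath (D : Digraph V) (C : Matrix V V ℝ) (j i : V) (p : List V) : Prop :=
  IsCriticalPath D C j i p ∧ ∀ q, IsCriticalPath D C j i q → q = p

/-- `C` is generic: every critical path is generic. -/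
def IsGeneric (D : Digraph V) (C : Matrix V V ℝ) : Prop :=
  ∀ j i p, IsCriticalPath D C j i p → IsGenericPath D C j i p

/-- The node set `S_p` of a path, which excludes the initial node. -/
def nodeSet [DecidableEq V] (p : List V) : Finset V := p.tail.toFinset

/-- The path length `ζ(p) = |S_p|`. -/
def pathLength [DecidableEq V] (p : List V) : ℕ := (nodeSet p).card

open Classical in
/-- The pairs `(j, i)` of distinct nodes with `b_{ji} > 0`. -/
noncomputable def positivePairs [Fintype V] (D : Digraph V) (C : Matrix V V ℝ) :
    Finset (V × V) :=
  Finset.univ.filter fun q => q.1 ≠ q.2 ∧ 0 < mlCoeff D C q.1 q.2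

end Graph

section Model

variable {V Ω : Type*} [MeasurableSpace Ω]

/-- `U` is a recursive max-linear vector with propagating noise on the DAG `D` with edge weight
matrix `C`, innovations `Z` and noise variables `ε`:
`U_i = (max_{k ∈ pa(i)} c_{ki} U_k ∨ Z_i) ε_i`, the maximum over the empty set being `0`. -/
structure IsRecursiveML (P : Measure Ω) (D : Digraph V) (C : Matrix V V ℝ)
    (Z ε U : V → Ω → ℝ) : Prop where
  isDAG : IsDAG D
  weights : IsEdgeWeightMatrix D C
  measurable_Z : ∀ i, Measurable (Z i)
  indep_Z : iIndepFun Z P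
  Z_pos : ∀ i, ∀ᵐ ω ∂P, 0 < Z i ω
  Z_support : ∀ i, (P.map (Z i)).support = Set.Ici 0
  Z_noAtoms : ∀ i, NullSingletonClass (P.map (Z i))
  measurable_ε : ∀ i, Measurable (ε i)
  indep_ε : iIndepFun ε P
  ident_ε : ∀ i k, IdentDistrib (ε i) (ε k) P P
  ε_noAtoms : ∀ i, NullSingletonClass (P.map (ε i))
  one_le_ε : ∀ i, ∀ᵐ ω ∂P, 1 ≤ ε i ω
  ε_unbounded : ∀ i, ∀ M : ℝ, 0 < P {ω | M < ε i ω}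
  indep_ε_Z : IndepFun (fun ω i => ε i ω) (fun ω i => Z i ω) P
  recursion : ∀ᵐ ω ∂P, ∀ i,
    U i ω = max (⨆ k : {k // D.Adj k i}, C k i * U k ω) (Z i ω) * ε i ω

/-- The random variable `Y` is positive and regularly varying at zero with exponent `α > 0`. -/
def IsRegularlyVaryingAtZero (P : Measure Ω) (Y : Ω → ℝ) (α : ℝ) : Prop :=
  0 < α ∧ (∀ᵐ ω ∂P, 0 < Y ω) ∧
    ∀ x : ℝ, 0 < x →
      Tendsto (fun t : ℝ => cdf (P.map Y) (t * x) / cdf (P.map Y) t) (𝓝[>] 0) (𝓝 (x ^ α))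

/-- The quantile function `F^←(u) = inf {x | F(x) ≥ u}` of the distribution function `F` of the
probability measure `μ`. -/
noncomputable def quantile (μ : Measure ℝ) (u : ℝ) : ℝ :=
  sInf {x | u ≤ cdf μ x}

/-- The distribution function of the Weibull distribution with the given shape and scale. -/
noncomputable def weibullCDF (shape scale x : ℝ) : ℝ :=
  if 0 < x then 1 - Real.exp (-(x / scale) ^ shape) else 0

variable {Ω' : Type*} [MeasurableSpace Ω']

/-- `X 0, X 1, …` is an iid sample from the random vector `U`. -/
structure IsIIDSample (P : Measure Ω) (U : V → Ω → ℝ) (P' : Measure Ω') (X : ℕ → Ω' → V → ℝ) :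
    Prop where
  indep : iIndepFun X P'
  ident : ∀ k, IdentDistrib (X k) (fun ω i => U i ω) P' P

/-- The minimum ratio estimator `min_k X^k_i / X^k_j` of `b_{ji}` from the first `n`
observations. -/
noncomputable def minRatio (X : ℕ → Ω' → V → ℝ) (n : ℕ) (j i : V) (ω : Ω') : ℝ :=
  ⨅ k : Fin n, X k ω i / X k ω j

end Model

end MaxLinear

/-! Unrolling the recursion shows that U_i is the maximum, over all paths q from some s to i, of
d(q) Z_s ∏_{k∈q} ε_k (`eq_solution`). Fix (j,i) with critical path p, S = S_p and b = b_{ji}, and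
let M be the ratio U_i/U_j computed with the noise in S set to 1 (`maskedRatio`). The nodes of S are
proper descendants of j, so masking leaves U_j unchanged. Almost surely b ∏_S ε ≤ U_i/U_j and M ≤
U_i/U_j ≤ (∏_S ε) M (`IsRecursiveML.ae_ratio`). As M is independent of ∏_S ε, P(U_i/U_j ≤ bx) lies
between P(M ≤ b) P(∏_S ε ≤ x) and P(M ≤ bx) P(∏_S ε ≤ x); right continuity then gives both
equivalences with c = P(M ≤ b). Genericity makes c positive: with Z_j > 1, the other innovations
bounded, ε_j huge and the other noise near 1, p beats all other paths. A huge Z_i makes c < 1.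

Logarithms turn the product into a sum of ζ(p) independent regularly varying variables, which is
regularly varying with exponent ζ(p)α (`exists_tendsto_cdf_add`). Since its distribution function is
continuous, n P(U_i/U_j ≤ b(1 + a_n x)) tends to c x^{ζ(p)α}.

Two different ratios are rarely near their bounds at once (`IsRecursiveML.tendsto_pair`). If the
node sets differ, a noise variable outside one of the products must also be near 1. If they agree,
so do the end nodes, and the ratio of the two starting values, which is atom-free, must be near a
constant. Either extra event is independent of one product and has vanishing probability. Hence the
probability that no ratio from a set T of pairs is small tends to exp(-∑ of the rates), which
factorises, and inclusion-exclusion yields the product of Weibull distribution functions. -/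

namespace MaxLinear

/-! ### Regular variation at zero: convolutions, atoms and quantiles. -/

section RegularVariation

variable {Ω : Type*} [MeasurableSpace Ω] {P : Measure Ω} [IsProbabilityMeasure P]

theorem cdf_map_eq {Y : Ω → ℝ} (hY : Measurable Y) (t : ℝ) :
    cdf (P.map Y) t = P.real {ω | Y ω ≤ t} := by
  have := Measure.isProbabilityMeasure_map (μ := P) hY.aemeasurable
  rw [cdf_eq_real, map_measureReal_apply hY measurableSet_Iic]
  rfl

theorem real_Ioc_eq {Y : Ω → ℝ} (hY : Measurable Y) {a b : ℝ} (hab : a ≤ b) :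
    P.real {ω | Y ω ∈ Set.Ioc a b} = cdf (P.map Y) b - cdf (P.map Y) a := by
  rw [cdf_map_eq hY, cdf_map_eq hY, ← measureReal_sdiff]
  · congr 1
    ext ω
    simp [and_comm]
  · intro ω h
    exact le_trans h hab
  · exact measurableSet_le hY measurable_const

omit [IsProbabilityMeasure P] in
theorem IndepFun.real_inter {β γ : Type*} [MeasurableSpace β] [MeasurableSpace γ]
    {X : Ω → β} {Y : Ω → γ} (h : IndepFun X Y P) {A : Set β} {B : Set γ}
    (hA : MeasurableSet A) (hB : MeasurableSet B) :
    P.real {ω | X ω ∈ A ∧ Y ω ∈ B} = P.real {ω | X ω ∈ A} * P.real {ω | Y ω ∈ B} := by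
  have := h.measure_inter_preimage_eq_mul A B hA hB
  simp only [Measure.real, ← ENNReal.toReal_mul]
  exact congrArg ENNReal.toReal this

theorem IsRegularlyVaryingAtZero.cdf_zero {Y : Ω → ℝ} {α : ℝ} (hY : Measurable Y)
    (h : IsRegularlyVaryingAtZero P Y α) : cdf (P.map Y) 0 = 0 := by
  rw [cdf_map_eq hY, measureReal_eq_zero_iff, measure_eq_zero_iff_ae_notMem]
  filter_upwards [h.2.1] with ω hω
  simpa using hω

omit [IsProbabilityMeasure P] in
-- A zero of F at some t > 0 forces F = 0 on (0, t); there the quotients are 0/0 = 0 and cannot tend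
-- to 1 ^ α.
theorem IsRegularlyVaryingAtZero.cdf_pos {Y : Ω → ℝ} {α : ℝ}
    (h : IsRegularlyVaryingAtZero P Y α) {t : ℝ} (ht : 0 < t) : 0 < cdf (P.map Y) t := by
  by_contra hc
  have h0 : cdf (P.map Y) t ≤ 0 := not_lt.1 hc
  have h1 := h.2.2 1 one_pos
  have h2 : Tendsto (fun t : ℝ => cdf (P.map Y) (t * 1) / cdf (P.map Y) t) (𝓝[>] 0) (𝓝 0) := by
    refine tendsto_const_nhds.congr' ?_
    filter_upwards [Ioo_mem_nhdsGT ht] with s hs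
    have : cdf (P.map Y) s = 0 :=
      le_antisymm ((monotone_cdf _ hs.2.le).trans h0) (cdf_nonneg _ _)
    simp [this]
  have := tendsto_nhds_unique h1 h2
  simp at this

/-- These are upper and lower Riemann–Stieltjes sums for the integral of (1 - u)^β against d(u^α) on
[0, 1]. Uniform continuity of x^β bounds each oscillation by η, and the weights telescope to 1. -/
theorem sum_sub_mul_rpow_lt {α β η : ℝ} (hα : 0 < α) (hβ : 0 < β) (hη : 0 < η) :
    ∃ N : ℕ, 0 < N ∧
      ∑ k ∈ Finset.range N, ((((k + 1 : ℕ) : ℝ) / N) ^ α - ((k : ℝ) / N) ^ α) *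
          (((N : ℝ) - k) / N) ^ β -
        ∑ k ∈ Finset.range N, ((((k + 1 : ℕ) : ℝ) / N) ^ α - ((k : ℝ) / N) ^ α) *
          (((N : ℝ) - (k + 1 : ℕ)) / N) ^ β ≤ η := by
  have hc : ContinuousOn (fun x : ℝ => x ^ β) (Set.Icc 0 1) :=
    (Real.continuous_rpow_const hβ.le).continuousOn
  have hu := isCompact_Icc.uniformContinuousOn_of_continuous hc
  rw [Metric.uniformContinuousOn_iff] at hu
  obtain ⟨δ, hδ, H⟩ := hu η hη
  obtain ⟨N, hN⟩ := exists_nat_one_div_lt hδ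
  refine ⟨N + 1, N.succ_pos, ?_⟩
  have hN0 : (0 : ℝ) < ((N + 1 : ℕ) : ℝ) := by positivity
  rw [← Finset.sum_sub_distrib]
  calc _ ≤ ∑ k ∈ Finset.range (N + 1), ((((k + 1 : ℕ) : ℝ) / (N + 1 : ℕ)) ^ α -
          ((k : ℝ) / (N + 1 : ℕ)) ^ α) * η := by
        refine Finset.sum_le_sum fun k hk => ?_
        have hk' : ((k + 1 : ℕ) : ℝ) ≤ ((N + 1 : ℕ) : ℝ) := by
          exact_mod_cast Finset.mem_range.1 hk
        have hk1 : (k : ℝ) ≤ ((N + 1 : ℕ) : ℝ) :=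
          le_trans (by push_cast; linarith) hk'
        have hk0 : (0 : ℝ) ≤ k := k.cast_nonneg
        rw [← mul_sub]
        refine mul_le_mul_of_nonneg_left ?_ (sub_nonneg.2 ?_)
        · have := H ((((N + 1 : ℕ) : ℝ) - k) / (N + 1 : ℕ))
            ⟨div_nonneg (by linarith) hN0.le, (div_le_one hN0).2 (by linarith)⟩
            ((((N + 1 : ℕ) : ℝ) - (k + 1 : ℕ)) / (N + 1 : ℕ))
            ⟨div_nonneg (by linarith) hN0.le,
              (div_le_one hN0).2 (by push_cast; linarith)⟩ ?_
          · exact (le_abs_self _).trans this.le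
          · rw [Real.dist_eq, ← sub_div]
            have : ((N + 1 : ℕ) : ℝ) - k - (((N + 1 : ℕ) : ℝ) - (k + 1 : ℕ)) = 1 := by
              push_cast; ring
            rw [this, abs_of_pos (by positivity)]
            simpa using hN
        · refine Real.rpow_le_rpow (by positivity) ?_ hα.le
          gcongr
          simp
    _ = η := by
        rw [← Finset.sum_mul, Finset.sum_range_sub (fun k : ℕ => ((k : ℝ) / (N + 1 : ℕ)) ^ α)]
        rw [div_self hN0.ne']
        simp [Real.zero_rpow hα.ne']

/-- The range (0, t] of X is cut into N cells. If X lies in a cell, then Y is at most t minus the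
left endpoint of that cell. -/
theorem real_add_le_le_sum {X Y : Ω → ℝ} (hX : Measurable X) (hY : Measurable Y)
    (hXY : IndepFun X Y P) (hX0 : ∀ᵐ ω ∂P, 0 < X ω) (hY0 : ∀ᵐ ω ∂P, 0 < Y ω)
    {N : ℕ} (hN : 0 < N) {t : ℝ} (ht : 0 < t) :
    P.real {ω | X ω + Y ω ≤ t} ≤ ∑ k ∈ Finset.range N,
      (cdf (P.map X) (t * (((k + 1 : ℕ) : ℝ) / N)) - cdf (P.map X) (t * ((k : ℝ) / N))) *
        cdf (P.map Y) (t * (((N : ℝ) - k) / N)) := by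
  have hN0 : (0 : ℝ) < N := by exact_mod_cast hN
  have hm : Monotone fun k : ℕ => t * ((k : ℝ) / N) := by
    intro a b hab
    have : (a : ℝ) ≤ b := by exact_mod_cast hab
    dsimp only
    gcongr
  calc P.real {ω | X ω + Y ω ≤ t}
      ≤ P.real (⋃ k ∈ Finset.range N, {ω | X ω ∈ Set.Ioc (t * ((k : ℝ) / N))
          (t * (((k + 1 : ℕ) : ℝ) / N)) ∧ Y ω ∈ Set.Iic (t * (((N : ℝ) - k) / N))}) := by
        refine ENNReal.toReal_mono (measure_ne_top _ _) (measure_mono_ae ?_)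
        filter_upwards [hX0, hY0] with ω h1 h2 h3
        replace h3 : X ω + Y ω ≤ t := h3
        have hmem : X ω ∈ Set.Ioc (t * (((0 : ℕ) : ℝ) / N)) (t * (((N : ℕ) : ℝ) / N)) := by
          rw [div_self hN0.ne']
          constructor
          · simpa using h1
          · linarith
        rw [← hm.biUnion_Ico_Ioc_map_succ 0 N] at hmem
        simp only [Set.mem_iUnion] at hmem
        obtain ⟨k, hk, hk'⟩ := hmem
        refine Set.mem_biUnion (x := k) (by simpa using hk.2) ⟨hk', ?_⟩
        have h4 : t * ((k : ℝ) / N) < X ω := hk'.1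
        have : t * (((N : ℝ) - k) / N) = t - t * ((k : ℝ) / N) := by
          field_simp
        rw [Set.mem_Iic, this]
        linarith
    _ ≤ _ := by
        refine (measureReal_biUnion_finset_le _ _).trans (Finset.sum_le_sum fun k _ => ?_)
        rw [IndepFun.real_inter hXY measurableSet_Ioc measurableSet_Iic,
          real_Ioc_eq hX (hm k.le_succ), cdf_map_eq hY]
        rfl

/-- Same cells, now with the right endpoint: the events are disjoint and each of them forces X + Y ≤
t. -/
theorem sum_le_real_add_le {X Y : Ω → ℝ} (hX : Measurable X) (hY : Measurable Y)
    (hXY : IndepFun X Y P) {N : ℕ} (hN : 0 < N) {t : ℝ} (ht : 0 < t) :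
    ∑ k ∈ Finset.range N,
      (cdf (P.map X) (t * (((k + 1 : ℕ) : ℝ) / N)) - cdf (P.map X) (t * ((k : ℝ) / N))) *
        cdf (P.map Y) (t * (((N : ℝ) - (k + 1 : ℕ)) / N)) ≤ P.real {ω | X ω + Y ω ≤ t} := by
  have hN0 : (0 : ℝ) < N := by exact_mod_cast hN
  have hm : Monotone fun k : ℕ => t * ((k : ℝ) / N) := by
    intro a b hab
    have : (a : ℝ) ≤ b := by exact_mod_cast hab
    dsimp only
    gcongr
  calc _ = P.real (⋃ k ∈ Finset.range N, {ω | X ω ∈ Set.Ioc (t * ((k : ℝ) / N))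
          (t * (((k + 1 : ℕ) : ℝ) / N)) ∧
            Y ω ∈ Set.Iic (t * (((N : ℝ) - (k + 1 : ℕ)) / N))}) := by
        rw [measureReal_biUnion_finset]
        · refine Finset.sum_congr rfl fun k _ => ?_
          rw [IndepFun.real_inter hXY measurableSet_Ioc measurableSet_Iic,
            real_Ioc_eq hX (hm k.le_succ), cdf_map_eq hY]
          rfl
        · intro a _ b _ hab
          refine Set.disjoint_left.2 fun ω ha hb => ?_
          exact Set.disjoint_left.1 (hm.pairwise_disjoint_on_Ioc_succ hab) ha.1 hb.1
        · intro k _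
          exact (hX measurableSet_Ioc).inter (hY measurableSet_Iic)
    _ ≤ _ := by
        refine measureReal_mono (Set.iUnion₂_subset fun k _ ω hω => ?_)
        have h1 : X ω ≤ t * (((k + 1 : ℕ) : ℝ) / N) := hω.1.2
        have h2 : Y ω ≤ t * (((N : ℝ) - (k + 1 : ℕ)) / N) := hω.2
        have : t * (((N : ℝ) - (k + 1 : ℕ)) / N) = t - t * (((k + 1 : ℕ) : ℝ) / N) := by
          field_simp
        change X ω + Y ω ≤ t
        linarith

theorem IsRegularlyVaryingAtZero.tendsto_of_nonneg {Y : Ω → ℝ} {α : ℝ} (hY : Measurable Y)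
    (h : IsRegularlyVaryingAtZero P Y α) {x : ℝ} (hx : 0 ≤ x) :
    Tendsto (fun t : ℝ => cdf (P.map Y) (t * x) / cdf (P.map Y) t) (𝓝[>] 0) (𝓝 (x ^ α)) := by
  rcases hx.eq_or_lt with rfl | hx
  · simp [h.cdf_zero hY, Real.zero_rpow h.1.ne']
  · exact h.2.2 x hx

/-- The distribution function of a sum of two independent regularly varying variables is
asymptotically a multiple of the product of their distribution functions. -/
theorem exists_tendsto_cdf_add {X Y : Ω → ℝ} {α β : ℝ} (hX : Measurable X) (hY : Measurable Y)
    (hXY : IndepFun X Y P) (hα : IsRegularlyVaryingAtZero P X α)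
    (hβ : IsRegularlyVaryingAtZero P Y β) :
    ∃ B : ℝ, 0 < B ∧ Tendsto (fun t : ℝ => cdf (P.map fun ω => X ω + Y ω) t /
      (cdf (P.map X) t * cdf (P.map Y) t)) (𝓝[>] 0) (𝓝 B) := by
  set F := cdf (P.map X)
  set H := cdf (P.map Y)
  set G := cdf (P.map fun ω => X ω + Y ω)
  have hlim : ∀ (a b : ℝ), 0 ≤ a → 0 ≤ b → ∀ c : ℝ, 0 ≤ c →
      Tendsto (fun t => (F (t * b) - F (t * a)) * H (t * c) / (F t * H t)) (𝓝[>] 0)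
        (𝓝 ((b ^ α - a ^ α) * c ^ β)) := by
    intro a b ha hb c hc
    have := ((hα.tendsto_of_nonneg hX hb).sub (hα.tendsto_of_nonneg hX ha)).mul
      (hβ.tendsto_of_nonneg hY hc)
    refine this.congr fun t => ?_
    rw [← sub_div, div_mul_div_comm]
  have hsum : ∀ (N : ℕ) (c : ℕ → ℝ), (∀ k ∈ Finset.range N, 0 ≤ c k) →
      Tendsto (fun t => (∑ k ∈ Finset.range N,
        (F (t * (((k + 1 : ℕ) : ℝ) / N)) - F (t * ((k : ℝ) / N))) * H (t * c k)) / (F t * H t))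
        (𝓝[>] 0)
        (𝓝 (∑ k ∈ Finset.range N, ((((k + 1 : ℕ) : ℝ) / N) ^ α - ((k : ℝ) / N) ^ α) *
          (c k) ^ β)) := by
    intro N c hc
    simp_rw [Finset.sum_div]
    exact tendsto_finsetSum _ fun k hk =>
      hlim _ _ (by positivity) (by positivity) _ (hc k hk)
  have hup : ∀ N : ℕ, 0 < N → ∀ᶠ t in 𝓝[>] (0 : ℝ), G t / (F t * H t) ≤ (∑ k ∈ Finset.range N,
        (F (t * (((k + 1 : ℕ) : ℝ) / N)) - F (t * ((k : ℝ) / N))) *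
          H (t * (((N : ℝ) - k) / N))) / (F t * H t) := by
    intro N hN
    filter_upwards [self_mem_nhdsWithin] with t ht
    refine div_le_div_of_nonneg_right ?_ (mul_nonneg (cdf_nonneg _ _) (cdf_nonneg _ _))
    rw [show G t = _ from cdf_map_eq (Measurable.fun_add hX hY) t]
    exact real_add_le_le_sum hX hY hXY hα.2.1 hβ.2.1 hN ht
  have hlo : ∀ N : ℕ, 0 < N → ∀ᶠ t in 𝓝[>] (0 : ℝ), (∑ k ∈ Finset.range N,
        (F (t * (((k + 1 : ℕ) : ℝ) / N)) - F (t * ((k : ℝ) / N))) *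
          H (t * (((N : ℝ) - (k + 1 : ℕ)) / N))) / (F t * H t) ≤ G t / (F t * H t) := by
    intro N hN
    filter_upwards [self_mem_nhdsWithin] with t ht
    refine div_le_div_of_nonneg_right ?_ (mul_nonneg (cdf_nonneg _ _) (cdf_nonneg _ _))
    rw [show G t = _ from cdf_map_eq (Measurable.fun_add hX hY) t]
    exact sum_le_real_add_le hX hY hXY hN ht
  have hupc : ∀ N : ℕ, ∀ k ∈ Finset.range N, 0 ≤ ((N : ℝ) - k) / N := by
    intro N k hk
    have : (k : ℝ) ≤ N := by exact_mod_cast (Finset.mem_range.1 hk).le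
    exact div_nonneg (by linarith) (by positivity)
  have hloc : ∀ N : ℕ, ∀ k ∈ Finset.range N, 0 ≤ ((N : ℝ) - (k + 1 : ℕ)) / N := by
    intro N k hk
    have : ((k + 1 : ℕ) : ℝ) ≤ N := by exact_mod_cast Finset.mem_range.1 hk
    exact div_nonneg (by linarith) (by positivity)
  -- The limit (a Beta integral) is never computed. The quotient is trapped between sums whose
  -- limits differ by at most η/4, which makes it Cauchy as t tends to 0.
  have hcauchy : Cauchy (map (fun t : ℝ => G t / (F t * H t)) (𝓝[>] 0)) := by
    rw [Metric.cauchy_iff]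
    refine ⟨inferInstance, fun η hη => ?_⟩
    obtain ⟨N, hN, hlt⟩ := sum_sub_mul_rpow_lt hα.1 hβ.1 (show (0 : ℝ) < η / 4 by positivity)
    have h1 := (hsum N _ (hupc N)).eventually_lt_const
      (lt_add_of_pos_right _ (show (0 : ℝ) < η / 4 by positivity))
    have h2 := (hsum N _ (hloc N)).eventually_const_lt
      (sub_lt_self _ (show (0 : ℝ) < η / 4 by positivity))
    refine ⟨_, image_mem_map (inter_mem (inter_mem h1 h2) (inter_mem (hup N hN) (hlo N hN))), ?_⟩
    rintro _ ⟨s, ⟨⟨hs1, hs2⟩, hs3, hs4⟩, rfl⟩ _ ⟨t, ⟨⟨ht1, ht2⟩, ht3, ht4⟩, rfl⟩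
    simp only [Set.mem_ofPred_eq] at hs1 hs2 hs3 hs4 ht1 ht2 ht3 ht4
    rw [Real.dist_eq, abs_lt]
    constructor <;> linarith
  obtain ⟨B, hB⟩ := cauchy_map_iff_exists_tendsto.1 hcauchy
  refine ⟨B, ?_, hB⟩
  -- Two cells already give the positive lower bound 2^(-α) 2^(-β).
  have hle := le_of_tendsto_of_tendsto (hsum 2 _ (hloc 2)) hB (hlo 2 two_pos)
  refine lt_of_lt_of_le ?_ hle
  norm_num [Finset.sum_range_succ, Real.zero_rpow hα.1.ne', Real.zero_rpow hβ.1.ne']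
  positivity

theorem IsRegularlyVaryingAtZero.add {X Y : Ω → ℝ} {α β : ℝ} (hX : Measurable X)
    (hY : Measurable Y) (hXY : IndepFun X Y P) (hα : IsRegularlyVaryingAtZero P X α)
    (hβ : IsRegularlyVaryingAtZero P Y β) :
    IsRegularlyVaryingAtZero P (fun ω => X ω + Y ω) (α + β) := by
  refine ⟨add_pos hα.1 hβ.1, ?_, fun x hx => ?_⟩
  · filter_upwards [hα.2.1, hβ.2.1] with ω h1 h2
    exact add_pos h1 h2
  obtain ⟨B, hB, hlim⟩ := exists_tendsto_cdf_add hX hY hXY hα hβ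
  have hmap : Tendsto (fun t : ℝ => t * x) (𝓝[>] 0) (𝓝[>] 0) := by
    refine tendsto_nhdsWithin_iff.2 ⟨?_, ?_⟩
    · have : Tendsto (fun t : ℝ => t * x) (𝓝 0) (𝓝 (0 * x)) := tendsto_id.mul_const x
      rw [zero_mul] at this
      exact this.mono_left nhdsWithin_le_nhds
    · filter_upwards [self_mem_nhdsWithin] with t ht
      exact mul_pos ht hx
  have h1 := ((hlim.comp hmap).div hlim hB.ne').mul ((hα.2.2 x hx).mul (hβ.2.2 x hx))
  rw [div_self hB.ne', one_mul, ← Real.rpow_add hx] at h1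
  refine h1.congr' ?_
  filter_upwards [self_mem_nhdsWithin] with t ht
  have a1 := (hα.cdf_pos ht).ne'
  have a2 := (hβ.cdf_pos ht).ne'
  have a3 := (hα.cdf_pos (mul_pos ht hx)).ne'
  have a4 := (hβ.cdf_pos (mul_pos ht hx)).ne'
  simp only [Function.comp, Pi.div_apply]
  by_cases h0 : cdf (P.map fun ω => X ω + Y ω) t = 0
  · simp [h0]
  field_simp

theorem IsRegularlyVaryingAtZero.finsetSum {ι : Type*} {Y : ι → Ω → ℝ} {α : ℝ}
    (hY : ∀ i, Measurable (Y i)) (hind : iIndepFun Y P)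
    (hα : ∀ i, IsRegularlyVaryingAtZero P (Y i) α) {S : Finset ι} (hS : S.Nonempty) :
    IsRegularlyVaryingAtZero P (fun ω => ∑ k ∈ S, Y k ω) (S.card * α) := by
  classical
  induction hS using Finset.Nonempty.cons_induction with
  | singleton a => simpa using hα a
  | cons a s ha hs ih =>
    have hi : IndepFun (fun ω => ∑ k ∈ s, Y k ω) (Y a) P := by
      have := hind.indepFun_finsetSum_of_notMem hY ha
      convert this using 1
      ext ω
      simp
    have := IsRegularlyVaryingAtZero.add (hY a) (Finset.measurable_fun_sum _ fun i _ => hY i)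
      hi.symm (hα a) ih
    simp only [Finset.sum_cons, Finset.card_cons]
    convert this using 1
    push_cast
    ring

/-- By Fubini: for each fixed value of Y, the atom-free X hits the single point g(Y) with
probability zero. -/
theorem measure_eq_zero_of_indepFun {β : Type*} [MeasurableSpace β] {X : Ω → ℝ} {Y : Ω → β}
    (hX : Measurable X) (hY : Measurable Y) (hXY : IndepFun X Y P)
    (hna : NullSingletonClass (P.map X)) {g : β → ℝ} (hg : Measurable g) :
    P {ω | X ω = g (Y ω)} = 0 := by
  have hind : IndepFun (fun ω => g (Y ω)) X P := (hXY.comp measurable_id hg).symm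
  have hm := (indepFun_iff_map_prod_eq_prod_map_map (hg.comp hY).aemeasurable
    hX.aemeasurable).1 hind
  have := Measure.isProbabilityMeasure_map (μ := P) hX.aemeasurable
  have hs : MeasurableSet {q : ℝ × ℝ | q.2 = q.1} := measurableSet_eq_fun measurable_snd
    measurable_fst
  have h0 : P.map (fun ω => (g (Y ω), X ω)) {q : ℝ × ℝ | q.2 = q.1} = 0 := by
    erw [hm, Measure.measure_prod_null hs]
    refine Eventually.of_forall fun a => ?_
    change P.map X {b | b = a} = 0
    exact measure_singleton a
  have hmeas : Measurable fun ω => (g (Y ω), X ω) := (hg.comp hY).prodMk hX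
  rwa [Measure.map_apply hmeas hs] at h0

omit [IsProbabilityMeasure P] in
theorem nullSingletonClass_map_iff {Y : Ω → ℝ} (hY : Measurable Y) :
    NullSingletonClass (P.map Y) ↔ ∀ c, P {ω | Y ω = c} = 0 := by
  have : ∀ c, P.map Y {c} = P {ω | Y ω = c} := fun c => by
    rw [Measure.map_apply hY (measurableSet_singleton c)]; rfl
  constructor
  · intro h c
    rw [← this]
    exact measure_singleton c
  · intro h
    exact ⟨fun c => (this c).trans (h c)⟩

theorem nullSingletonClass_map_finsetSum {ι : Type*} {Y : ι → Ω → ℝ}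
    (hY : ∀ i, Measurable (Y i)) (hind : iIndepFun Y P)
    (hna : ∀ i, NullSingletonClass (P.map (Y i))) {S : Finset ι} (hS : S.Nonempty) :
    NullSingletonClass (P.map fun ω => ∑ k ∈ S, Y k ω) := by
  classical
  obtain ⟨a, ha⟩ := hS
  have hm : Measurable fun ω => ∑ k ∈ S.erase a, Y k ω :=
    Finset.measurable_fun_sum _ fun i _ => hY i
  have hi : IndepFun (fun ω => ∑ k ∈ S.erase a, Y k ω) (Y a) P := by
    have := hind.indepFun_finsetSum_of_notMem hY (Finset.notMem_erase a S)
    convert this using 1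
    ext ω
    simp
  rw [nullSingletonClass_map_iff (Finset.measurable_fun_sum _ fun i _ => hY i)]
  intro c
  rw [← measure_eq_zero_of_indepFun (hY a) hm hi.symm (hna a)
    (g := fun y : ℝ => c - y) (measurable_id.const_sub c)]
  congr 1
  ext ω
  simp only [Set.mem_ofPred_eq, ← Finset.add_sum_erase S (fun k => Y k ω) ha]
  constructor <;> intro h <;> linarith

omit [IsProbabilityMeasure P] in
-- Allows a moving argument y n in place of a fixed x. Monotonicity of the distribution function
-- squeezes it between fixed arguments z on either side of x, so no uniform convergence is required.
theorem IsRegularlyVaryingAtZero.tendsto_div {Y : Ω → ℝ} {γ : ℝ}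
    (h : IsRegularlyVaryingAtZero P Y γ) {t y : ℕ → ℝ} (ht : Tendsto t atTop (𝓝[>] 0)) {x : ℝ}
    (hx : 0 < x) (hy : Tendsto y atTop (𝓝 x)) :
    Tendsto (fun n => cdf (P.map Y) (t n * y n) / cdf (P.map Y) (t n)) atTop (𝓝 (x ^ γ)) := by
  have hc : ContinuousAt (fun z : ℝ => z ^ γ) x := Real.continuousAt_rpow_const _ _ (.inl hx.ne')
  have ht0 : ∀ᶠ n in atTop, 0 < t n := ht.eventually self_mem_nhdsWithin
  rw [tendsto_order]
  constructor
  · intro a ha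
    have : ∀ᶠ z in 𝓝 x, a < z ^ γ := hc.eventually (lt_mem_nhds ha)
    obtain ⟨z, ⟨hz, hz0⟩, hzx⟩ : ∃ z, (a < z ^ γ ∧ 0 < z) ∧ z < x :=
      ((((this.and (lt_mem_nhds hx)).filter_mono nhdsWithin_le_nhds).and
        (self_mem_nhdsWithin : Set.Iio x ∈ 𝓝[<] x)).exists)
    filter_upwards [((h.2.2 z hz0).comp ht).eventually (lt_mem_nhds hz),
      hy.eventually (lt_mem_nhds hzx), ht0] with n h1 h2 h3
    refine h1.trans_le (div_le_div_of_nonneg_right (monotone_cdf _ ?_) (cdf_nonneg _ _))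
    exact mul_le_mul_of_nonneg_left h2.le h3.le
  · intro a ha
    have : ∀ᶠ z in 𝓝 x, z ^ γ < a := hc.eventually (gt_mem_nhds ha)
    obtain ⟨z, ⟨hz, hz0⟩, hzx⟩ : ∃ z, (z ^ γ < a ∧ 0 < z) ∧ x < z :=
      ((((this.and (lt_mem_nhds hx)).filter_mono nhdsWithin_le_nhds).and
        (self_mem_nhdsWithin : Set.Ioi x ∈ 𝓝[>] x)).exists)
    filter_upwards [((h.2.2 z hz0).comp ht).eventually (gt_mem_nhds hz),
      hy.eventually (gt_mem_nhds hzx), ht0] with n h1 h2 h3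
    refine (div_le_div_of_nonneg_right (monotone_cdf _ ?_) (cdf_nonneg _ _)).trans_lt h1
    exact mul_le_mul_of_nonneg_left h2.le h3.le

theorem continuous_cdf_of_nullSingletonClass (μ : Measure ℝ) [IsProbabilityMeasure μ]
    [NullSingletonClass μ] : Continuous (cdf μ) := by
  rw [continuous_iff_continuousAt]
  intro x
  have h : (cdf μ).measure {x} = 0 := by
    rw [measure_cdf]
    exact measure_singleton x
  rw [StieltjesFunction.measure_singleton, ENNReal.ofReal_eq_zero] at h
  have h1 : Function.leftLim (cdf μ) x = cdf μ x :=
    le_antisymm ((cdf μ).mono.leftLim_le le_rfl) (by linarith)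
  rw [(cdf μ).mono.continuousAt_iff_leftLim_eq_rightLim, h1]
  exact ((cdf μ).rightLim_eq x).symm

/-- Without atoms the distribution function is continuous: it attains u, and the closed set defining
the quantile contains its infimum. -/
theorem cdf_quantile (μ : Measure ℝ) [IsProbabilityMeasure μ] [NullSingletonClass μ] {u : ℝ}
    (hu : u ∈ Set.Ioo (0 : ℝ) 1) : cdf μ (quantile μ u) = u := by
  have hc := continuous_cdf_of_nullSingletonClass μ
  obtain ⟨y, hy⟩ : ∃ y, cdf μ y = u := by
    obtain ⟨a, ha⟩ := ((tendsto_cdf_atBot μ).eventually (gt_mem_nhds hu.1)).exists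
    obtain ⟨b, hb⟩ := ((tendsto_cdf_atTop μ).eventually (lt_mem_nhds hu.2)).exists
    exact mem_range_of_exists_le_of_exists_ge hc ⟨a, ha.le⟩ ⟨b, hb.le⟩
  obtain ⟨a, ha⟩ := ((tendsto_cdf_atBot μ).eventually (gt_mem_nhds hu.1)).exists
  have hbdd : BddBelow {x | u ≤ cdf μ x} :=
    ⟨a, fun x hx => le_of_lt (lt_of_not_ge fun h =>
      absurd ((monotone_cdf μ h).trans_lt ha) (not_lt.2 hx))⟩
  have hcl : IsClosed {x | u ≤ cdf μ x} := isClosed_le continuous_const hc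
  refine le_antisymm ?_ (hcl.csInf_mem ⟨y, hy.ge⟩ hbdd)
  exact (monotone_cdf μ (csInf_le hbdd hy.ge)).trans hy.le

theorem IsRegularlyVaryingAtZero.quantile_pos {Y : Ω → ℝ} {γ : ℝ} (hY : Measurable Y)
    (h : IsRegularlyVaryingAtZero P Y γ) [NullSingletonClass (P.map Y)] {u : ℝ}
    (hu : u ∈ Set.Ioo (0 : ℝ) 1) : 0 < quantile (P.map Y) u := by
  have := Measure.isProbabilityMeasure_map (μ := P) hY.aemeasurable
  by_contra hc
  have := monotone_cdf (P.map Y) (not_lt.1 hc)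
  rw [cdf_quantile _ hu, h.cdf_zero hY] at this
  exact absurd hu.1 (not_lt.2 this)

theorem one_div_natCast_mem_Ioo {n : ℕ} (hn : 2 ≤ n) : 1 / (n : ℝ) ∈ Set.Ioo (0 : ℝ) 1 := by
  have : (2 : ℝ) ≤ n := by exact_mod_cast hn
  exact ⟨by positivity, (div_lt_one (by linarith)).2 (by linarith)⟩

theorem IsRegularlyVaryingAtZero.tendsto_quantile {Y : Ω → ℝ} {γ : ℝ} (hY : Measurable Y)
    (h : IsRegularlyVaryingAtZero P Y γ) [NullSingletonClass (P.map Y)] :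
    Tendsto (fun n : ℕ => quantile (P.map Y) (1 / (n : ℝ))) atTop (𝓝[>] 0) := by
  have := Measure.isProbabilityMeasure_map (μ := P) hY.aemeasurable
  refine tendsto_nhdsWithin_iff.2 ⟨?_, ?_⟩
  · rw [tendsto_order]
    constructor
    · intro a ha
      filter_upwards [eventually_ge_atTop 2] with n hn
      exact ha.trans (h.quantile_pos hY (one_div_natCast_mem_Ioo hn))
    · intro a ha
      filter_upwards [eventually_ge_atTop 2,
        tendsto_one_div_atTop_nhds_zero_nat.eventually (gt_mem_nhds (h.cdf_pos ha))] with n hn h1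
      by_contra hc
      have := monotone_cdf (P.map Y) (not_lt.1 hc)
      rw [cdf_quantile _ (one_div_natCast_mem_Ioo hn)] at this
      linarith
  · filter_upwards [eventually_ge_atTop 2] with n hn
    exact h.quantile_pos hY (one_div_natCast_mem_Ioo hn)

/-- With q_n the quantile at 1/n, F(q_n) = 1/n turns n F(s_n) into F(q_n · s_n/q_n) / F(q_n). -/
theorem IsRegularlyVaryingAtZero.tendsto_nat_mul_cdf {Y : Ω → ℝ} {γ : ℝ} (hY : Measurable Y)
    (h : IsRegularlyVaryingAtZero P Y γ) [NullSingletonClass (P.map Y)] {s : ℕ → ℝ} {x : ℝ}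
    (hx : 0 < x)
    (hs : Tendsto (fun n : ℕ => s n / quantile (P.map Y) (1 / (n : ℝ))) atTop (𝓝 x)) :
    Tendsto (fun n : ℕ => n * cdf (P.map Y) (s n)) atTop (𝓝 (x ^ γ)) := by
  have := Measure.isProbabilityMeasure_map (μ := P) hY.aemeasurable
  refine (h.tendsto_div (h.tendsto_quantile hY) hx hs).congr' ?_
  filter_upwards [eventually_ge_atTop 2] with n hn
  have hu := one_div_natCast_mem_Ioo hn
  rw [cdf_quantile _ hu, mul_div_cancel₀ _ (h.quantile_pos hY hu).ne', div_div_eq_mul_div, div_one,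
    mul_comm]

end RegularVariation

/-! ### Splitting, joining and weighing paths in a DAG. -/

section Paths

variable {V : Type*} {D : Digraph V} {C : Matrix V V ℝ} {s j i k : V} {p q t : List V}

theorem IsPath.ne_nil (h : IsPath D j i p) : p ≠ [] := by
  rintro rfl
  simpa using h.head

theorem isPath_singleton (i : V) : IsPath D i i [i] := ⟨by simp, by simp, by simp⟩

theorem IsPath.exists_cons (h : IsPath D j i p) : ∃ t, p = j :: t := by
  cases p with
  | nil => exact absurd rfl h.ne_nil
  | cons a t => exact ⟨t, by simpa using h.head⟩

theorem IsPath.exists_concat (h : IsPath D j i p) : ∃ t, p = t ++ [i] :=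
  ⟨p.dropLast, (List.dropLast_append_getLast? i h.last).symm⟩

theorem isPath_cons_cons {a b : V} :
    IsPath D a i (a :: b :: t) ↔ D.Adj a b ∧ IsPath D b i (b :: t) := by
  constructor
  · rintro ⟨h1, -, h3⟩
    rw [List.isChain_cons_cons] at h1
    exact ⟨h1.1, h1.2, rfl, by simpa using h3⟩
  · rintro ⟨h, h1, -, h3⟩
    exact ⟨List.isChain_cons_cons.2 ⟨h, h1⟩, rfl, by simpa using h3⟩

theorem IsPath.append (hq : IsPath D s j q) (ht : IsPath D j i (j :: t)) :
    IsPath D s i (q ++ t) := by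
  induction q generalizing s with
  | nil => exact absurd rfl hq.ne_nil
  | cons a l ih =>
    obtain rfl : a = s := by simpa using hq.head
    cases l with
    | nil =>
      obtain rfl : a = j := by simpa using hq.last
      exact ht
    | cons b l =>
      rw [isPath_cons_cons] at hq
      exact isPath_cons_cons.2 ⟨hq.1, ih hq.2⟩

/-- The node j is kept as the last entry of `q₁` and is absent from `t`, so that node products over
the two pieces multiply without counting j twice. -/
theorem IsPath.exists_append (h : IsPath D s i q) (hj : j ∈ q) :
    ∃ q₁ t, q = q₁ ++ t ∧ IsPath D s j q₁ ∧ IsPath D j i (j :: t) := by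
  induction q generalizing s with
  | nil => exact absurd rfl h.ne_nil
  | cons a l ih =>
    obtain rfl : a = s := by simpa using h.head
    by_cases haj : j = a
    · subst haj
      exact ⟨[j], l, rfl, isPath_singleton _, h⟩
    cases l with
    | nil => simp [haj] at hj
    | cons b l =>
      rw [isPath_cons_cons] at h
      obtain ⟨q₁, t, h1, h2, h3⟩ := ih h.2 (by simpa [haj] using hj)
      obtain ⟨q₂, rfl⟩ := h2.exists_cons
      exact ⟨a :: b :: q₂, t, by rw [h1]; rfl, isPath_cons_cons.2 ⟨h.1, h2⟩, h3⟩

theorem pathWeight_cons_cons (a b : V) (t : List V) :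
    pathWeight C (a :: b :: t) = C a b * pathWeight C (b :: t) := by
  simp [pathWeight]

@[simp] theorem pathWeight_singleton (a : V) : pathWeight C [a] = 1 := by simp [pathWeight]

theorem IsPath.pathWeight_append (hq : IsPath D s j q) (t : List V) :
    pathWeight C (q ++ t) = pathWeight C q * pathWeight C (j :: t) := by
  induction q generalizing s with
  | nil => exact absurd rfl hq.ne_nil
  | cons a l ih =>
    obtain rfl : a = s := by simpa using hq.head
    cases l with
    | nil =>
      obtain rfl : a = j := by simpa using hq.last
      simp
    | cons b l =>
      rw [isPath_cons_cons] at hq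
      have := ih hq.2
      simp only [List.cons_append] at this ⊢
      rw [pathWeight_cons_cons, this, pathWeight_cons_cons, mul_assoc]

theorem IsPath.pathWeight_pos (hC : IsEdgeWeightMatrix D C) (hq : IsPath D s j q) :
    0 < pathWeight C q := by
  induction q generalizing s with
  | nil => exact absurd rfl hq.ne_nil
  | cons a l ih =>
    obtain rfl : a = s := by simpa using hq.head
    cases l with
    | nil => simp
    | cons b l =>
      rw [isPath_cons_cons] at hq
      rw [pathWeight_cons_cons]
      exact mul_pos (hC.pos _ _ hq.1) (ih hq.2)

theorem IsPath.reflTransGen (h : IsPath D s i q) : Relation.ReflTransGen D.Adj s i := by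
  induction q generalizing s with
  | nil => exact absurd rfl h.ne_nil
  | cons a l ih =>
    obtain rfl : a = s := by simpa using h.head
    cases l with
    | nil =>
      obtain rfl : a = i := by simpa using h.last
      exact .refl
    | cons b l =>
      rw [isPath_cons_cons] at h
      exact .head h.1 (ih h.2)

theorem IsPath.reflTransGen_of_mem (h : IsPath D s i q) (hk : k ∈ q) :
    Relation.ReflTransGen D.Adj k i := by
  obtain ⟨q₁, t, -, -, h3⟩ := h.exists_append hk
  exact h3.reflTransGen

theorem IsPath.transGen_of_mem_tail (h : IsPath D s i (s :: t)) (hk : k ∈ t) :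
    Relation.TransGen D.Adj s k := by
  cases t with
  | nil => simp at hk
  | cons b l =>
    rw [isPath_cons_cons] at h
    obtain ⟨q₁, t, -, h2, -⟩ := h.2.exists_append hk
    exact .head' h.1 h2.reflTransGen

theorem IsPath.last_mem (h : IsPath D s i q) : i ∈ q := by
  obtain ⟨t, rfl⟩ := h.exists_concat
  simp

theorem IsPath.last_mem_tail (h : IsPath D s i (s :: t)) (hsi : s ≠ i) : i ∈ t := by
  simpa [hsi.symm] using h.last_mem

theorem IsDAG.ne_of_transGen (hD : IsDAG D) (h : Relation.TransGen D.Adj j i) : j ≠ i := by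
  rintro rfl
  exact hD _ h

theorem IsPath.nodup (hD : IsDAG D) (h : IsPath D s i q) : q.Nodup := by
  have h1 : q.IsChain (Relation.TransGen D.Adj) := h.chain.imp fun _ _ => .single
  exact h1.pairwise.imp fun h => hD.ne_of_transGen h

theorem finite_paths [Finite V] (hD : IsDAG D) (i : V) :
    {q : V × List V | IsPath D q.1 i q.2}.Finite := by
  classical
  have := Fintype.ofFinite V
  have h1 : {l : List V | l.Nodup}.Finite := (Set.finite_coe_iff (s := {l : List V | l.Nodup})).1
    (inferInstanceAs (Finite {l : List V // l.Nodup}))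
  exact (Set.finite_univ.prod h1).subset fun q hq => ⟨trivial, IsPath.nodup hD hq⟩

theorem IsPath.le_mlCoeff [Finite V] (hD : IsDAG D) (h : IsPath D j i p) :
    pathWeight C p ≤ mlCoeff D C j i := by
  have hf := (finite_paths hD i).image fun q => pathWeight C q.2
  refine le_csSup (hf.subset ?_).bddAbove ⟨p, h, rfl⟩
  rintro w ⟨p, hp, rfl⟩
  exact ⟨(j, p), hp, rfl⟩

/-- Genericity enters the argument only here, as a strict gap between the critical path and its
competitors. -/
theorem IsCriticalPath.lt_of_ne [Finite V] (hD : IsDAG D) (hC : IsGeneric D C)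
    (hp : IsCriticalPath D C j i p) (hq : IsPath D j i q) (hqp : q ≠ p) :
    pathWeight C q < pathWeight C p := by
  rw [hp.2]
  refine lt_of_le_of_ne (hq.le_mlCoeff hD) fun h => hqp ?_
  exact (hC _ _ _ hp).2 q ⟨hq, h⟩

end Paths

/-! ### The path representation and the effect of masking noise. -/

section Solution

variable {V : Type*} [DecidableEq V] {D : Digraph V} {C : Matrix V V ℝ} {s j i k : V}
  {p q t : List V} {z e e' u : V → ℝ}

/-- The path representation of the recursive max-linear vector with innovations `z` and noise
variables `e`. -/
noncomputable def solution (D : Digraph V) (C : Matrix V V ℝ) (z e : V → ℝ) (i : V) : ℝ :=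
  ⨆ q : {q : V × List V // IsPath D q.1 i q.2},
    pathWeight C q.1.2 * z q.1.1 * ∏ k ∈ q.1.2.toFinset, e k

/-- The noise vector `e` with the entries in `S` replaced by `1`. -/
def mask (S : Finset V) (e : V → ℝ) (k : V) : ℝ := if k ∈ S then 1 else e k

theorem mask_of_mem {S : Finset V} (h : k ∈ S) : mask S e k = 1 := if_pos h

theorem mask_of_notMem {S : Finset V} (h : k ∉ S) : mask S e k = e k := if_neg h

theorem one_le_mask {S : Finset V} (he : ∀ k, 1 ≤ e k) (k : V) : 1 ≤ mask S e k := by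
  unfold mask
  split_ifs
  exacts [le_rfl, he k]

theorem mask_le {S : Finset V} (he : ∀ k, 1 ≤ e k) (k : V) : mask S e k ≤ e k := by
  unfold mask
  split_ifs
  exacts [he k, le_rfl]

theorem prod_eq_prod_mask {S A : Finset V} :
    ∏ k ∈ A, e k = (∏ k ∈ A.filter (· ∈ S), e k) * ∏ k ∈ A, mask S e k := by
  rw [← Finset.prod_filter_mul_prod_filter_not A (· ∈ S) e,
    ← Finset.prod_filter_mul_prod_filter_not A (· ∈ S) (mask S e),
    Finset.prod_eq_one (s := A.filter (· ∈ S)) (f := mask S e) fun k hk =>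
      mask_of_mem (Finset.mem_filter.1 hk).2, one_mul]
  congr 1
  exact Finset.prod_congr rfl fun k hk => (mask_of_notMem (Finset.mem_filter.1 hk).2).symm

variable [Finite V]

theorem le_solution (hD : IsDAG D) (h : IsPath D s i q) :
    pathWeight C q * z s * ∏ k ∈ q.toFinset, e k ≤ solution D C z e i := by
  have : Finite {q : V × List V // IsPath D q.1 i q.2} := (finite_paths hD i).to_subtype
  exact le_ciSup (f := fun q : {q : V × List V // IsPath D q.1 i q.2} =>
    pathWeight C q.1.2 * z q.1.1 * ∏ k ∈ q.1.2.toFinset, e k) (Set.finite_range _).bddAbove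
    ⟨(s, q), h⟩

theorem exists_eq_solution (hD : IsDAG D) (z e : V → ℝ) (i : V) : ∃ s q, IsPath D s i q ∧
    pathWeight C q * z s * ∏ k ∈ q.toFinset, e k = solution D C z e i := by
  have : Finite {q : V × List V // IsPath D q.1 i q.2} := (finite_paths hD i).to_subtype
  have : Nonempty {q : V × List V // IsPath D q.1 i q.2} := ⟨(i, [i]), isPath_singleton i⟩
  obtain ⟨⟨⟨s, q⟩, h⟩, hq⟩ := exists_eq_ciSup_of_finite
    (f := fun q : {q : V × List V // IsPath D q.1 i q.2} =>
      pathWeight C q.1.2 * z q.1.1 * ∏ k ∈ q.1.2.toFinset, e k)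
  exact ⟨s, q, h, hq⟩

theorem mul_le_solution (hD : IsDAG D) (i : V) : z i * e i ≤ solution D C z e i := by
  simpa using le_solution (C := C) (z := z) (e := e) hD (isPath_singleton i)

theorem solution_pos (hD : IsDAG D) (hz : ∀ i, 0 < z i) (he : ∀ i, 0 < e i) (i : V) :
    0 < solution D C z e i :=
  (mul_pos (hz i) (he i)).trans_le (mul_le_solution hD i)

omit [Finite V] in
theorem IsPath.toFinset_append (hD : IsDAG D) (hq : IsPath D s j q)
    (ht : IsPath D j i (j :: t)) :
    ∏ k ∈ (q ++ t).toFinset, e k = (∏ k ∈ q.toFinset, e k) * ∏ k ∈ t.toFinset, e k := by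
  rw [List.toFinset_append, Finset.prod_union]
  have := (hq.append ht).nodup hD
  rw [Finset.disjoint_left]
  intro k h1 h2
  exact (List.nodup_append'.1 this).2.2 (List.mem_toFinset.1 h1) (List.mem_toFinset.1 h2)

/-- A maximising path into j, prolonged along the given path, competes in the maximum at i. -/
theorem IsPath.mul_solution_le (hD : IsDAG D) (ht : IsPath D j i (j :: t)) :
    pathWeight C (j :: t) * (∏ k ∈ t.toFinset, e k) * solution D C z e j ≤
      solution D C z e i := by
  obtain ⟨s, q, hq, h⟩ := exists_eq_solution (C := C) hD z e j
  have := le_solution (C := C) (z := z) (e := e) hD (hq.append ht)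
  rw [hq.pathWeight_append, hq.toFinset_append hD ht] at this
  rw [← h]
  linarith

omit [Finite V] in
theorem solution_congr (h : ∀ k, Relation.ReflTransGen D.Adj k i → e k = e' k) :
    solution D C z e i = solution D C z e' i := by
  unfold solution
  congr 1
  ext q
  congr 1
  exact Finset.prod_congr rfl fun k hk =>
    h k (q.2.reflTransGen_of_mem (List.mem_toFinset.1 hk))

omit [Finite V] in
-- Only ancestors of j (and j itself) matter at j; by acyclicity none of them is a proper descendant
-- of j.
theorem solution_mask (hD : IsDAG D) {S : Finset V}
    (hS : ∀ k ∈ S, Relation.TransGen D.Adj j k) :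
    solution D C z (mask S e) j = solution D C z e j :=
  solution_congr fun _ hk => mask_of_notMem fun hkS => hD _ ((hS _ hkS).trans_left hk)

theorem solution_mono (hD : IsDAG D) (hC : IsEdgeWeightMatrix D C) (hz : ∀ i, 0 < z i)
    (he : ∀ i, 0 ≤ e i) (hee : ∀ i, e i ≤ e' i) : solution D C z e i ≤ solution D C z e' i := by
  obtain ⟨s, q, hq, h⟩ := exists_eq_solution (C := C) hD z e i
  rw [← h]
  refine le_trans ?_ (le_solution hD hq)
  exact mul_le_mul_of_nonneg_left (Finset.prod_le_prod (fun k _ => he k) fun k _ => hee k)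
    (mul_pos (hq.pathWeight_pos hC) (hz s)).le

/-- Unmasking multiplies the value of each path by the noise of those of its nodes that lie in S,
hence by at most the full product over S, as all noise is at least 1. -/
theorem solution_le_prod_mul (hD : IsDAG D) (hC : IsEdgeWeightMatrix D C) (hz : ∀ i, 0 < z i)
    (he : ∀ i, 1 ≤ e i) (S : Finset V) :
    solution D C z e i ≤ (∏ k ∈ S, e k) * solution D C z (mask S e) i := by
  obtain ⟨s, q, hq, h⟩ := exists_eq_solution (C := C) hD z e i
  have h1 : ∏ k ∈ q.toFinset.filter (· ∈ S), e k ≤ ∏ k ∈ S, e k :=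
    Finset.prod_le_prod_of_subset_of_one_le (fun k hk => (Finset.mem_filter.1 hk).2)
      (fun k _ => zero_le_one.trans (he k)) fun k _ _ => he k
  have h2 : 0 ≤ pathWeight C q * z s * ∏ k ∈ q.toFinset, mask S e k :=
    mul_nonneg (mul_pos (hq.pathWeight_pos hC) (hz s)).le
      (Finset.prod_nonneg fun k _ => zero_le_one.trans (one_le_mask he k))
  have h3 : 0 ≤ ∏ k ∈ S, e k := Finset.prod_nonneg fun k _ => zero_le_one.trans (he k)
  calc solution D C z e i = (∏ k ∈ q.toFinset.filter (· ∈ S), e k) *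
        (pathWeight C q * z s * ∏ k ∈ q.toFinset, mask S e k) := by
        rw [← h, prod_eq_prod_mask (S := S)]
        ring
    _ ≤ (∏ k ∈ S, e k) * (pathWeight C q * z s * ∏ k ∈ q.toFinset, mask S e k) :=
        mul_le_mul_of_nonneg_right h1 h2
    _ ≤ _ := mul_le_mul_of_nonneg_left (le_solution hD hq) h3

omit [Finite V] in
-- Every path into i contains i exactly once in its node set, so e i factors out of the maximum.
theorem solution_eq_mul_mask (he : 0 ≤ e i) :
    solution D C z e i = e i * solution D C z (mask {i} e) i := by
  have hkey : ∀ s q, IsPath D s i q → ∏ k ∈ q.toFinset, e k =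
      e i * ∏ k ∈ q.toFinset, mask {i} e k := by
    intro s q hq
    rw [prod_eq_prod_mask (S := {i})]
    congr 1
    rw [show q.toFinset.filter (· ∈ ({i} : Finset V)) = {i} from ?_, Finset.prod_singleton]
    ext k
    simp only [Finset.mem_filter, List.mem_toFinset, Finset.mem_singleton, and_iff_right_iff_imp]
    rintro rfl
    exact hq.last_mem
  unfold solution
  rw [Real.mul_iSup_of_nonneg he]
  congr 1
  ext q
  rw [hkey _ _ q.2]
  ring

theorem measurable_solution (D : Digraph V) (C : Matrix V V ℝ) (i : V) :
    Measurable fun y : (V → ℝ) × (V → ℝ) => solution D C y.2 y.1 i := by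
  have : Countable {q : V × List V // IsPath D q.1 i q.2} := inferInstance
  refine Measurable.iSup fun q => ?_
  refine Measurable.mul ?_ ?_
  · exact ((measurable_pi_apply _).comp measurable_snd).const_mul _
  · exact Finset.measurable_fun_prod _ fun k _ => (measurable_pi_apply k).comp measurable_fst

/-- The recursion determines the vector, which is given by its path representation. -/
theorem eq_solution (hD : IsDAG D) (hC : IsEdgeWeightMatrix D C) (hz : ∀ i, 0 < z i)
    (he : ∀ i, 0 < e i)
    (hu : ∀ i, u i = max (⨆ k : {k // D.Adj k i}, C k i * u k) (z i) * e i) (i : V) :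
    u i = solution D C z e i := by
  have hwf : WellFounded D.Adj := by
    have : Std.Irrefl (Relation.TransGen D.Adj) := ⟨hD⟩
    exact (Finite.wellFounded_of_trans_of_irrefl (Relation.TransGen D.Adj)).mono
      fun _ _ => .single
  induction i using hwf.induction with
  | _ i ih =>
  rw [hu]
  refine le_antisymm ?_ ?_
  · rw [max_mul_of_nonneg _ _ (he i).le]
    refine max_le ?_ (mul_le_solution hD i)
    -- At a node without parents the supremum is over the empty type and equals 0.
    rcases isEmpty_or_nonempty {k // D.Adj k i} with hE | hE
    · rw [Real.iSup_of_isEmpty, zero_mul]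
      exact (solution_pos hD hz he i).le
    · obtain ⟨⟨k, hk⟩, hk'⟩ := exists_eq_ciSup_of_finite
        (f := fun k : {k // D.Adj k i} => C k i * u k)
      rw [← hk', ih k hk]
      have hp : IsPath D k i [k, i] := isPath_cons_cons.2 ⟨hk, isPath_singleton i⟩
      have := hp.mul_solution_le (C := C) (z := z) (e := e) hD
      rw [pathWeight_cons_cons, pathWeight_singleton] at this
      simp only [List.toFinset_cons, List.toFinset_nil, insert_empty_eq,
        Finset.prod_singleton] at this
      linarith
  · obtain ⟨s, q, hq, h⟩ := exists_eq_solution (C := C) hD z e i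
    rw [← h]
    obtain ⟨l, rfl⟩ := hq.exists_concat
    -- A maximising path is either trivial, bounded by the innovation at i, or enters i through a
    -- parent k, where the induction hypothesis applies.
    rcases List.eq_nil_or_concat' l with rfl | ⟨l, k, rfl⟩
    · obtain rfl : i = s := by simpa using hq.head
      simp only [List.nil_append, pathWeight_singleton, one_mul, List.toFinset_cons,
        List.toFinset_nil, insert_empty_eq, Finset.prod_singleton]
      exact mul_le_mul_of_nonneg_right (le_max_right _ _) (he i).le
    · have hki : D.Adj k i := by
        have := hq.chain
        simp [List.isChain_append] at this
        exact this.2.1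
      have hk : IsPath D s k (l ++ [k]) := by
        refine ⟨hq.chain.left_of_append, ?_, by simp⟩
        have := hq.head
        cases l <;> simpa using this
      have hp : IsPath D k i [k, i] := isPath_cons_cons.2 ⟨hki, isPath_singleton i⟩
      have h1 := le_solution (C := C) (z := z) (e := e) hD hk
      have h2 : C k i * u k ≤ ⨆ k : {k // D.Adj k i}, C k i * u k :=
        le_ciSup (f := fun k : {k // D.Adj k i} => C k i * u k)
          (Set.finite_range _).bddAbove ⟨k, hki⟩
      rw [hk.pathWeight_append, hk.toFinset_append hD hp, pathWeight_cons_cons,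
        pathWeight_singleton]
      simp only [List.toFinset_cons, List.toFinset_nil, insert_empty_eq,
        Finset.prod_singleton, mul_one]
      calc _ = C k i * (pathWeight C (l ++ [k]) * z s * ∏ k ∈ (l ++ [k]).toFinset, e k) * e i := by
            ring
        _ ≤ C k i * u k * e i := by
            rw [ih k hki]
            exact mul_le_mul_of_nonneg_right
              (mul_le_mul_of_nonneg_left h1 (hC.pos _ _ hki).le) (he i).le
        _ ≤ _ := mul_le_mul_of_nonneg_right (h2.trans (le_max_left _ _)) (he i).le

end Solution

/-! ### Deterministic bounds on path maxima. -/

section Deterministic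

variable {V : Type*} [Fintype V] [DecidableEq V] {D : Digraph V} {C : Matrix V V ℝ} {j i : V}
  {p t : List V} {z e : V → ℝ}

omit [DecidableEq V] in
theorem prod_le_pow_card {A : Finset V} {K : ℝ} (hK : 1 ≤ K) (he : ∀ k ∈ A, 0 ≤ e k)
    (heK : ∀ k ∈ A, e k ≤ K) : ∏ k ∈ A, e k ≤ K ^ Fintype.card V :=
  calc ∏ k ∈ A, e k ≤ ∏ _k ∈ A, K := Finset.prod_le_prod he heK
    _ = K ^ A.card := Finset.prod_const K
    _ ≤ K ^ Fintype.card V := pow_le_pow_right₀ hK (Finset.card_le_univ A)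

omit [DecidableEq V] in
theorem exists_pathWeight_le (C : Matrix V V ℝ) (hD : IsDAG D) (i : V) :
    ∃ W : ℝ, 0 < W ∧ ∀ s q, IsPath D s i q → pathWeight C q ≤ W := by
  obtain ⟨W, hW⟩ := ((finite_paths hD i).image fun q => pathWeight C q.2).bddAbove
  exact ⟨max W 1, by positivity,
    fun s q hq => (hW ⟨(s, q), hq, rfl⟩).trans (le_max_left _ _)⟩

theorem solution_le_of_le (hD : IsDAG D) (hC : IsEdgeWeightMatrix D C) {W K : ℝ} (hK : 1 ≤ K)
    (hW : ∀ s q, IsPath D s j q → pathWeight C q ≤ W) (hz : ∀ k, 0 < z k)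
    (hzK : ∀ k, Relation.ReflTransGen D.Adj k j → z k ≤ K)
    (he : ∀ k, 0 ≤ e k) (heK : ∀ k, Relation.ReflTransGen D.Adj k j → e k ≤ K) :
    solution D C z e j ≤ W * K * K ^ Fintype.card V := by
  obtain ⟨s, q, hq, h⟩ := exists_eq_solution (C := C) hD z e j
  rw [← h]
  have h1 := hW s q hq
  have h2 := hq.pathWeight_pos hC
  have h3 := hzK s hq.reflTransGen
  have h4 : ∏ k ∈ q.toFinset, e k ≤ K ^ Fintype.card V := prod_le_pow_card hK (fun k _ => he k)
    fun k hk => heK k (hq.reflTransGen_of_mem (List.mem_toFinset.1 hk))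
  have h5 : 0 ≤ ∏ k ∈ q.toFinset, e k := Finset.prod_nonneg fun k _ => he k
  have h6 := hz s
  have h7 : 0 < W := h2.trans_le h1
  gcongr

/-- If the noise at `j` is large and the other noise variables are close to one, then the
critical path dominates all other paths. -/
theorem exists_solution_mask_le (hD : IsDAG D) (hC : IsEdgeWeightMatrix D C)
    (hG : IsGeneric D C) (hp : IsCriticalPath D C j i (j :: t)) {K : ℝ} (hK : 1 ≤ K) :
    ∃ x M : ℝ, 1 < x ∧ ∀ z e : V → ℝ, (∀ k, 0 < z k) → (∀ k, 1 ≤ e k) → 1 < z j →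
      (∀ k, k ≠ j → z k ≤ K) → M < e j → (∀ k, k ≠ j → e k ≤ x) →
      solution D C z (mask t.toFinset e) i ≤ pathWeight C (j :: t) * solution D C z e j := by
  set b := pathWeight C (j :: t) with hb
  have hb0 : 0 < b := hp.1.pathWeight_pos hC
  obtain ⟨W, hW0, hW⟩ := exists_pathWeight_le C hD i
  -- Each of the finitely many non-critical paths from j has weight strictly below b, so there is
  -- room for a factor x per node if x is close to 1.
  have hx : ∀ᶠ x in 𝓝[>] (1 : ℝ), (∀ q ∈ {q : V × List V | IsPath D q.1 i q.2},
      q.1 = j → q.2 ≠ j :: t → pathWeight C q.2 * x ^ Fintype.card V ≤ b) := by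
    rw [eventually_all_finite (finite_paths hD i)]
    rintro ⟨s, q⟩ hq
    by_cases h : s = j ∧ q ≠ j :: t
    · obtain ⟨rfl, h⟩ := h
      have hlt := hp.lt_of_ne hD hG hq h
      have : Tendsto (fun x : ℝ => pathWeight C q * x ^ Fintype.card V) (𝓝 1)
          (𝓝 (pathWeight C q * 1 ^ Fintype.card V)) := by
        have : Continuous fun x : ℝ => pathWeight C q * x ^ Fintype.card V := by fun_prop
        exact this.tendsto 1
      rw [one_pow, mul_one] at this
      filter_upwards [(this.mono_left nhdsWithin_le_nhds).eventually (gt_mem_nhds hlt)]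
        with x hx _ _ using hx.le
    · exact Eventually.of_forall fun x h1 h2 => absurd ⟨h1, h2⟩ h
  obtain ⟨x, hx, hx1, hx2⟩ := (hx.and (Ioo_mem_nhdsGT one_lt_two)).exists
  -- As x < 2, a path avoiding j is worth at most W K 2^|V|; this M makes b z_j e_j at least that
  -- large.
  refine ⟨x, W * K * 2 ^ Fintype.card V / b, hx1, fun z e hz he hzj hzK hej hex => ?_⟩
  have hm0 : ∀ k, 0 ≤ mask t.toFinset e k := fun k => zero_le_one.trans (one_le_mask he k)
  obtain ⟨s, q, hq, h⟩ := exists_eq_solution (C := C) hD z (mask t.toFinset e) i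
  rw [← h]
  have hqw := hq.pathWeight_pos hC
  by_cases hjq : j ∈ q
  -- A path through j splits there: the part up to j is worth at most the value at j, and the
  -- remainder contributes a factor of at most b.
  · obtain ⟨q₁, r, rfl, h2, h3⟩ := hq.exists_append hjq
    rw [h2.pathWeight_append, h2.toFinset_append hD h3]
    have h4 := le_solution (C := C) (z := z) (e := mask t.toFinset e) hD h2
    rw [solution_mask hD fun k hk => hp.1.transGen_of_mem_tail (List.mem_toFinset.1 hk)] at h4
    have h5 : pathWeight C (j :: r) * ∏ k ∈ r.toFinset, mask t.toFinset e k ≤ b := by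
      by_cases hrt : r = t
      · subst hrt
        rw [Finset.prod_eq_one fun k hk => mask_of_mem hk, mul_one]
      · refine le_trans (mul_le_mul_of_nonneg_left (prod_le_pow_card hx1.le (fun k _ => hm0 k)
          fun k hk => (mask_le he k).trans (hex k ?_)) (h3.pathWeight_pos hC).le)
          (hx (j, j :: r) h3 rfl (by simpa using hrt))
        exact (hD.ne_of_transGen (h3.transGen_of_mem_tail (List.mem_toFinset.1 hk))).symm
    have h6 : 0 ≤ solution D C z e j :=
      (solution_pos hD hz (fun k => zero_lt_one.trans_le (he k)) j).le
    calc _ = (pathWeight C q₁ * z s * ∏ k ∈ q₁.toFinset, mask t.toFinset e k) *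
          (pathWeight C (j :: r) * ∏ k ∈ r.toFinset, mask t.toFinset e k) := by ring
      _ ≤ solution D C z e j * b := mul_le_mul h4 h5
          (mul_nonneg (h3.pathWeight_pos hC).le (Finset.prod_nonneg fun k _ => hm0 k)) h6
      _ = _ := mul_comm _ _
  · have hsj : s ≠ j := by
      rintro rfl
      obtain ⟨r, rfl⟩ := hq.exists_cons
      simp at hjq
    have h4 : ∏ k ∈ q.toFinset, mask t.toFinset e k ≤ 2 ^ Fintype.card V :=
      prod_le_pow_card one_le_two (fun k _ => hm0 k) fun k hk =>
        (mask_le he k).trans ((hex k (by rintro rfl; exact hjq (List.mem_toFinset.1 hk))).trans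
          hx2.le)
    have h5 := hz s
    have h6 := hzK s hsj
    have h7 : 0 ≤ ∏ k ∈ q.toFinset, mask t.toFinset e k := Finset.prod_nonneg fun k _ => hm0 k
    calc _ ≤ W * K * 2 ^ Fintype.card V := by
          have := hW s q hq
          gcongr
      _ = b * (W * K * 2 ^ Fintype.card V / b) := by field_simp
      _ ≤ b * (z j * e j) := by
          have : 1 * (W * K * 2 ^ Fintype.card V / b) ≤ z j * e j := by
            have : 0 ≤ W * K * 2 ^ Fintype.card V / b := by positivity
            exact mul_le_mul hzj.le hej.le this (by linarith)
          rw [one_mul] at this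
          gcongr
      _ ≤ _ := mul_le_mul_of_nonneg_left (mul_le_solution hD j) hb0.le

end Deterministic

/-! ### The random model: independence, and the constant c lies in (0, 1). -/

section Model

variable {V Ω : Type*} [Fintype V] [DecidableEq V] [MeasurableSpace Ω] {P : Measure Ω}
  [IsProbabilityMeasure P] {D : Digraph V} {C : Matrix V V ℝ} {Z ε U : V → Ω → ℝ}

omit [DecidableEq V] [IsProbabilityMeasure P] in
theorem IsRecursiveML.ae_good (hU : IsRecursiveML P D C Z ε U) :
    ∀ᵐ ω ∂P, (∀ k, 0 < Z k ω) ∧ ∀ k, 1 ≤ ε k ω :=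
  (ae_all_iff.2 hU.Z_pos).and (ae_all_iff.2 hU.one_le_ε)

omit [IsProbabilityMeasure P] in
theorem IsRecursiveML.ae_eq_solution (hU : IsRecursiveML P D C Z ε U) :
    ∀ᵐ ω ∂P, ∀ i, U i ω = solution D C (fun k => Z k ω) (fun k => ε k ω) i := by
  filter_upwards [hU.ae_good, hU.recursion] with ω h1 h2 i
  exact eq_solution hU.isDAG hU.weights h1.1 (fun k => zero_lt_one.trans_le (h1.2 k)) h2 i

omit [Fintype V] [IsProbabilityMeasure P] in
theorem IsRecursiveML.measurable_noise (hU : IsRecursiveML P D C Z ε U) (S : Finset V) :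
    Measurable fun ω => (mask S (fun k => ε k ω), fun k => Z k ω) := by
  refine Measurable.prodMk (measurable_pi_lambda _ fun k => ?_)
    (measurable_pi_lambda _ hU.measurable_Z)
  by_cases h : k ∈ S
  · simp only [mask_of_mem h, measurable_const]
  · simpa only [mask_of_notMem h] using hU.measurable_ε k

/-- The product of the noise variables over `S` is independent of all other noise variables and
the innovations. -/
theorem IsRecursiveML.indepFun_mask (hU : IsRecursiveML P D C Z ε U) (S : Finset V) :
    IndepFun (fun ω => ∏ k ∈ S, ε k ω)
      (fun ω => (mask S (fun k => ε k ω), fun k => Z k ω)) P := by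
  set X : Ω → ℝ := fun ω => ∏ k ∈ S, ε k ω
  set Y : Ω → V → ℝ := fun ω => mask S (fun k => ε k ω)
  set T : Ω → V → ℝ := fun ω k => Z k ω
  have hX : Measurable X := Finset.measurable_fun_prod _ fun k _ => hU.measurable_ε k
  have hY : Measurable Y := (hU.measurable_noise S).fst
  have hT : Measurable T := (hU.measurable_noise S).snd
  have h1 : IndepFun X Y P := by
    have h := hU.indep_ε.indepFun_finset S Sᶜ disjoint_compl_right hU.measurable_ε
    have hf : Measurable fun f : S → ℝ => ∏ k, f k :=
      Finset.measurable_fun_prod _ fun k _ => measurable_pi_apply k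
    have hg : Measurable fun (f : (Sᶜ : Finset V) → ℝ) (k : V) =>
        if h : k ∈ S then (1 : ℝ) else f ⟨k, Finset.mem_compl.2 h⟩ := by
      refine measurable_pi_lambda _ fun k => ?_
      by_cases hk : k ∈ S
      · simp only [hk, dite_true, measurable_const]
      · simpa only [hk, dite_false] using measurable_pi_apply _
    have := h.comp hf hg
    convert this using 1
    · ext ω
      exact (Finset.prod_coe_sort S fun k => ε k ω).symm
    · ext ω k
      by_cases hk : k ∈ S <;> simp [Y, mask, hk]
  have h2 : IndepFun (fun ω => (X ω, Y ω)) T P := by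
    have hf : Measurable fun e : V → ℝ => (∏ k ∈ S, e k, mask S e) := by
      refine (Finset.measurable_fun_prod _ fun k _ => measurable_pi_apply k).prodMk
        (measurable_pi_lambda _ fun k => ?_)
      by_cases hk : k ∈ S
      · simp only [mask_of_mem hk, measurable_const]
      · simpa only [mask_of_notMem hk] using measurable_pi_apply k
    exact hU.indep_ε_Z.comp hf measurable_id
  have := Measure.isProbabilityMeasure_map (μ := P) hX.aemeasurable
  have := Measure.isProbabilityMeasure_map (μ := P) hY.aemeasurable
  have := Measure.isProbabilityMeasure_map (μ := P) hT.aemeasurable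
  rw [indepFun_iff_map_prod_eq_prod_map_map hX.aemeasurable (hY.prodMk hT).aemeasurable]
  rw [indepFun_iff_map_prod_eq_prod_map_map hX.aemeasurable hY.aemeasurable] at h1
  rw [indepFun_iff_map_prod_eq_prod_map_map (hX.prodMk hY).aemeasurable hT.aemeasurable, h1] at h2
  -- Projecting the law of ((X, Y), T) shows that Y and T are independent; reassociating the triple
  -- product then separates X from (Y, T).
  have h3 : P.map (fun ω => (Y ω, T ω)) = (P.map Y).prod (P.map T) := by
    have := congrArg (Measure.map fun q : (ℝ × (V → ℝ)) × (V → ℝ) => (q.1.2, q.2)) h2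
    rw [Measure.map_map (by fun_prop) ((hX.prodMk hY).prodMk hT)] at this
    refine this.trans ?_
    have h4 := Measure.map_prod_map ((P.map X).prod (P.map Y)) (P.map T) measurable_snd
      measurable_id
    rw [Measure.map_snd_prod, Measure.map_id, measure_univ, one_smul] at h4
    exact h4.symm
  rw [h3, ← Measure.prodAssoc_prod, ← h2,
    Measure.map_map (MeasurableEquiv.measurable _) ((hX.prodMk hY).prodMk hT)]
  rfl

omit [DecidableEq V] [IsProbabilityMeasure P] in
theorem IsRecursiveML.measure_pos (hU : IsRecursiveML P D C Z ε U) {A B : V → Set ℝ}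
    (hA : ∀ k, MeasurableSet (A k)) (hB : ∀ k, MeasurableSet (B k))
    (hA0 : ∀ k, 0 < P {ω | ε k ω ∈ A k}) (hB0 : ∀ k, 0 < P {ω | Z k ω ∈ B k}) :
    0 < P {ω | (∀ k, ε k ω ∈ A k) ∧ ∀ k, Z k ω ∈ B k} := by
  have h1 := hU.indep_ε_Z.measure_inter_preimage_eq_mul (Set.univ.pi A) (Set.univ.pi B)
    (.univ_pi hA) (.univ_pi hB)
  have h2 := hU.indep_ε.measure_inter_preimage_eq_mul Finset.univ (sets := A) fun k _ => hA k
  have h3 := hU.indep_Z.measure_inter_preimage_eq_mul Finset.univ (sets := B) fun k _ => hB k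
  have e1 : {ω | (∀ k, ε k ω ∈ A k) ∧ ∀ k, Z k ω ∈ B k} =
      (fun ω i => ε i ω) ⁻¹' (Set.univ.pi A) ∩ (fun ω i => Z i ω) ⁻¹' (Set.univ.pi B) := by
    ext ω; simp
  have e2 : (fun ω i => ε i ω) ⁻¹' (Set.univ.pi A) = ⋂ k ∈ Finset.univ, ε k ⁻¹' A k := by
    ext ω; simp
  have e3 : (fun ω i => Z i ω) ⁻¹' (Set.univ.pi B) = ⋂ k ∈ Finset.univ, Z k ⁻¹' B k := by
    ext ω; simp
  rw [e1, h1, e2, e3, h2, h3]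
  exact ENNReal.mul_pos (Finset.prod_ne_zero_iff.2 fun k _ => (hA0 k).ne')
    (Finset.prod_ne_zero_iff.2 fun k _ => (hB0 k).ne')

theorem exists_forall_measure_le_pos {ι : Type*} [Finite ι] (Y : ι → Ω → ℝ) :
    ∃ K : ℝ, 1 ≤ K ∧ ∀ i, 0 < P {ω | Y i ω ≤ K} := by
  have h : ∀ i, ∀ᶠ n : ℕ in atTop, 0 < P {ω | Y i ω ≤ n} := by
    intro i
    have hm : Monotone fun n : ℕ => {ω | Y i ω ≤ n} := fun a b hab ω h =>
      show Y i ω ≤ b from le_trans h (by exact_mod_cast hab)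
    have ht := tendsto_measure_iUnion_atTop (μ := P) hm
    have hun : ⋃ n : ℕ, {ω | Y i ω ≤ n} = Set.univ :=
      Set.eq_univ_of_forall fun ω => Set.mem_iUnion.2 (exists_nat_ge (Y i ω))
    rw [hun, measure_univ] at ht
    exact ht.eventually (lt_mem_nhds one_pos)
  obtain ⟨n, h1, h2⟩ := ((eventually_all.2 h).and (eventually_ge_atTop 1)).exists
  exact ⟨n, by exact_mod_cast h2, h1⟩

omit [Fintype V] [DecidableEq V] [IsProbabilityMeasure P] in
theorem IsRecursiveML.measure_lt_Z_pos (hU : IsRecursiveML P D C Z ε U) (k : V) {M : ℝ}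
    (hM : 0 ≤ M) : 0 < P {ω | M < Z k ω} := by
  have h : M + 1 ∈ (P.map (Z k)).support := by
    rw [hU.Z_support]
    exact (by linarith : (0 : ℝ) ≤ M + 1)
  have := (Measure.mem_support_iff_forall _).1 h (Set.Ioi M) (Ioi_mem_nhds (by linarith))
  rwa [Measure.map_apply (hU.measurable_Z k) measurableSet_Ioi] at this

theorem measure_le_pos {α : ℝ} {Y : Ω → ℝ} (hY : Measurable Y) (h1 : ∀ᵐ ω ∂P, 1 ≤ Y ω)
    (hα : IsRegularlyVaryingAtZero P (fun ω => Real.log (Y ω)) α) {x : ℝ} (hx : 1 < x) :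
    0 < P {ω | Y ω ≤ x} := by
  have h := hα.cdf_pos (Real.log_pos hx)
  rw [cdf_map_eq hY.log] at h
  refine (ENNReal.toReal_pos_iff.1 h).1.trans_le (measure_mono_ae ?_)
  filter_upwards [h1] with ω hω h
  exact (Real.log_le_log_iff (by linarith) (by linarith)).1 h

/-- The ratio `U_i / U_j` if the noise variables in `S` are replaced by `1`. -/
noncomputable def maskedRatio (D : Digraph V) (C : Matrix V V ℝ) (Z ε : V → Ω → ℝ)
    (S : Finset V) (j i : V) (ω : Ω) : ℝ :=
  solution D C (fun k => Z k ω) (mask S fun k => ε k ω) i /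
    solution D C (fun k => Z k ω) (mask S fun k => ε k ω) j

omit [IsProbabilityMeasure P] in
theorem IsRecursiveML.measurable_maskedRatio (hU : IsRecursiveML P D C Z ε U) (S : Finset V)
    (j i : V) : Measurable (maskedRatio D C Z ε S j i) :=
  ((measurable_solution D C i).comp (hU.measurable_noise S)).div
    ((measurable_solution D C j).comp (hU.measurable_noise S))

theorem IsRecursiveML.indepFun_maskedRatio (hU : IsRecursiveML P D C Z ε U) (S : Finset V)
    (j i : V) : IndepFun (fun ω => ∏ k ∈ S, ε k ω) (maskedRatio D C Z ε S j i) P :=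
  (hU.indepFun_mask S).comp measurable_id
    ((measurable_solution D C i).div (measurable_solution D C j))

omit [IsProbabilityMeasure P] in
-- The inequalities behind all later estimates: the ratio is compared with the product over the path
-- and with the masked ratio, two independent variables.
theorem IsRecursiveML.ae_ratio (hU : IsRecursiveML P D C Z ε U) {j i : V} {t : List V}
    (hp : IsPath D j i (j :: t)) :
    ∀ᵐ ω ∂P, pathWeight C (j :: t) * ∏ k ∈ t.toFinset, ε k ω ≤ U i ω / U j ω ∧
      maskedRatio D C Z ε t.toFinset j i ω ≤ U i ω / U j ω ∧
      U i ω / U j ω ≤ (∏ k ∈ t.toFinset, ε k ω) * maskedRatio D C Z ε t.toFinset j i ω ∧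
      1 ≤ ∏ k ∈ t.toFinset, ε k ω := by
  filter_upwards [hU.ae_good, hU.ae_eq_solution] with ω ⟨hz, he⟩ h
  have he0 : ∀ k, 0 < ε k ω := fun k => zero_lt_one.trans_le (he k)
  have hj := solution_pos (C := C) hU.isDAG hz he0 j
  have hm : solution D C (fun k => Z k ω) (mask t.toFinset fun k => ε k ω) j =
      solution D C (fun k => Z k ω) (fun k => ε k ω) j :=
    solution_mask hU.isDAG fun k hk => hp.transGen_of_mem_tail (List.mem_toFinset.1 hk)
  rw [h i, h j, maskedRatio, hm, ← mul_div_assoc]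
  refine ⟨(le_div_iff₀ hj).2 (hp.mul_solution_le hU.isDAG), ?_, ?_, ?_⟩
  · exact div_le_div_of_nonneg_right (solution_mono hU.isDAG hU.weights hz
      (fun k => zero_le_one.trans (one_le_mask he k)) (mask_le he)) hj.le
  · exact div_le_div_of_nonneg_right
      (solution_le_prod_mul hU.isDAG hU.weights hz he _) hj.le
  · exact Finset.one_le_prod fun k _ => he k

theorem IsRecursiveML.real_maskedRatio_le_pos (hU : IsRecursiveML P D C Z ε U) {α : ℝ}
    (hα : ∀ i, IsRegularlyVaryingAtZero P (fun ω => Real.log (ε i ω)) α)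
    (hG : IsGeneric D C) {j i : V} {t : List V} (hp : IsCriticalPath D C j i (j :: t)) :
    0 < P.real {ω | maskedRatio D C Z ε t.toFinset j i ω ≤ pathWeight C (j :: t)} := by
  obtain ⟨K, hK, hZK⟩ := exists_forall_measure_le_pos (P := P) Z
  obtain ⟨x, M, hx, H⟩ := exists_solution_mask_le hU.isDAG hU.weights hG hp hK
  -- Regular variation puts noise near 1 with positive probability, unboundedness makes it huge at
  -- j, and the full support of the innovations allows Z j > 1.
  have hpos := hU.measure_pos (A := fun k => if k = j then Set.Ioi M else Set.Iic x)
    (B := fun k => if k = j then Set.Ioi 1 else Set.Iic K)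
    (fun k => by split_ifs; exacts [measurableSet_Ioi, measurableSet_Iic])
    (fun k => by split_ifs; exacts [measurableSet_Ioi, measurableSet_Iic])
    (fun k => by
      split_ifs
      exacts [hU.ε_unbounded k M,
        measure_le_pos (hU.measurable_ε k) (hU.one_le_ε k) (hα k) hx])
    (fun k => by
      split_ifs
      exacts [hU.measure_lt_Z_pos k zero_le_one, hZK k])
  refine ENNReal.toReal_pos (hpos.trans_le (measure_mono_ae ?_)).ne' (measure_ne_top _ _)
  filter_upwards [hU.ae_good] with ω ⟨hz, he⟩ ⟨h1, h2⟩
  have hm : solution D C (fun k => Z k ω) (mask t.toFinset fun k => ε k ω) j =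
      solution D C (fun k => Z k ω) (fun k => ε k ω) j :=
    solution_mask hU.isDAG fun k hk => hp.1.transGen_of_mem_tail (List.mem_toFinset.1 hk)
  change maskedRatio D C Z ε t.toFinset j i ω ≤ _
  rw [maskedRatio, hm, div_le_iff₀
    (solution_pos hU.isDAG hz (fun k => zero_lt_one.trans_le (he k)) j)]
  refine H _ _ hz he ?_ ?_ ?_ ?_
  · simpa using h2 j
  · intro k hk
    simpa [hk] using h2 k
  · simpa using h1 j
  · intro k hk
    simpa [hk] using h1 k

theorem IsRecursiveML.real_maskedRatio_le_lt_one (hU : IsRecursiveML P D C Z ε U)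
    {j i : V} (hji : j ≠ i) {t : List V} (hp : IsPath D j i (j :: t)) :
    P.real {ω | maskedRatio D C Z ε t.toFinset j i ω ≤ pathWeight C (j :: t)} < 1 := by
  obtain ⟨K, hK, hKpos⟩ := exists_forall_measure_le_pos (P := P) (Sum.elim Z ε)
  obtain ⟨W, hW0, hW⟩ := exists_pathWeight_le C hU.isDAG j
  set b := pathWeight C (j :: t)
  have hb : 0 < b := hp.pathWeight_pos hU.weights
  -- If everything other than Z i is at most K, this bounds b times the value at j. The noise at i
  -- is masked, so Z i > M alone pushes the masked ratio above b.
  set M := b * (W * K * K ^ Fintype.card V)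
  have hM : 0 ≤ M := by positivity
  have hpos := hU.measure_pos (A := fun _ => Set.Iic K)
    (B := fun k => if k = i then Set.Ioi M else Set.Iic K) (fun _ => measurableSet_Iic)
    (fun k => by split_ifs; exacts [measurableSet_Ioi, measurableSet_Iic])
    (fun k => hKpos (.inr k))
    (fun k => by
      split_ifs
      exacts [hU.measure_lt_Z_pos k hM, hKpos (.inl k)])
  have hpos' : 0 < P.real {ω | maskedRatio D C Z ε t.toFinset j i ω ≤ b}ᶜ := by
    refine ENNReal.toReal_pos (hpos.trans_le (measure_mono_ae ?_)).ne' (measure_ne_top _ _)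
    filter_upwards [hU.ae_good] with ω ⟨hz, he⟩ ⟨h1, h2⟩
    have hm : solution D C (fun k => Z k ω) (mask t.toFinset fun k => ε k ω) j =
        solution D C (fun k => Z k ω) (fun k => ε k ω) j :=
      solution_mask hU.isDAG fun k hk => hp.transGen_of_mem_tail (List.mem_toFinset.1 hk)
    change ¬ maskedRatio D C Z ε t.toFinset j i ω ≤ _
    rw [maskedRatio, hm, not_le,
      lt_div_iff₀ (solution_pos hU.isDAG hz (fun k => zero_lt_one.trans_le (he k)) j)]
    have h3 : solution D C (fun k => Z k ω) (fun k => ε k ω) j ≤ W * K * K ^ Fintype.card V := by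
      refine solution_le_of_le hU.isDAG hU.weights hK hW hz (fun k hk => ?_)
        (fun k => zero_le_one.trans (he k)) fun k _ => h1 k
      have hki : k ≠ i := by
        rintro rfl
        exact hU.isDAG _ ((hp.transGen_of_mem_tail (hp.last_mem_tail hji)).trans_left hk)
      simpa [hki] using h2 k
    have h4 := mul_le_solution (C := C) (z := fun k => Z k ω)
      (e := mask t.toFinset fun k => ε k ω) hU.isDAG i
    rw [mask_of_mem (List.mem_toFinset.2 (hp.last_mem_tail hji)), mul_one] at h4
    have h5 : M < Z i ω := by simpa using h2 i
    exact (mul_le_mul_of_nonneg_left h3 hb.le).trans_lt (h5.trans_le h4)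
  rw [probReal_compl_eq_one_sub
    (measurableSet_le (hU.measurable_maskedRatio _ _ _) measurable_const)] at hpos'
  linarith

end Model

/-! ### Tail equivalence, normalising sequences and negligible pairs. -/

section Asymptotics

variable {V Ω : Type*} [Fintype V] [DecidableEq V] [MeasurableSpace Ω] {P : Measure Ω}
  [IsProbabilityMeasure P] {D : Digraph V} {C : Matrix V V ℝ} {Z ε U : V → Ω → ℝ} {α : ℝ}
  {j i : V} {t : List V}

theorem real_mono_ae {Ω : Type*} [MeasurableSpace Ω] {P : Measure Ω} [IsFiniteMeasure P]
    {A B : Set Ω} (h : ∀ᵐ ω ∂P, ω ∈ A → ω ∈ B) : P.real A ≤ P.real B :=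
  ENNReal.toReal_mono (measure_ne_top _ _) (measure_mono_ae h)

theorem isEquivalent_of_le_of_le {ι : Type*} {l : Filter ι} {f h w : ι → ℝ} {c : ℝ}
    (hc : 0 < c) (hh : ∀ᶠ x in l, 0 < h x) (hw : Tendsto w l (𝓝 c))
    (h1 : ∀ᶠ x in l, c * h x ≤ f x) (h2 : ∀ᶠ x in l, f x ≤ h x * w x) :
    Asymptotics.IsEquivalent l f fun x => c * h x := by
  refine Asymptotics.isEquivalent_of_tendsto_one ?_
  have hw' : Tendsto (fun x => w x / c) l (𝓝 1) := by
    simpa [div_self hc.ne'] using hw.div_const c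
  refine tendsto_of_tendsto_of_tendsto_of_le_of_le' tendsto_const_nhds hw' ?_ ?_
  · filter_upwards [h1, hh] with x h1 hh
    simpa using (one_le_div (mul_pos hc hh)).2 h1
  · filter_upwards [h2, hh] with x h2 hh
    simp only [Pi.div_apply]
    rw [div_le_div_iff₀ (mul_pos hc hh) hc]
    calc f x * c ≤ h x * w x * c := by gcongr
      _ = _ := by ring

omit [Fintype V] [DecidableEq V] [IsProbabilityMeasure P] in
theorem IsRecursiveML.measurable_sum_log (hU : IsRecursiveML P D C Z ε U) (S : Finset V) :
    Measurable fun ω => ∑ k ∈ S, Real.log (ε k ω) :=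
  Finset.measurable_fun_sum _ fun k _ => (hU.measurable_ε k).log

omit [DecidableEq V] in
theorem IsRecursiveML.real_prod_le (hU : IsRecursiveML P D C Z ε U) (S : Finset V) {x : ℝ}
    (hx : 0 < x) : P.real {ω | ∏ k ∈ S, ε k ω ≤ x} =
      cdf (P.map fun ω => ∑ k ∈ S, Real.log (ε k ω)) (Real.log x) := by
  rw [cdf_map_eq (hU.measurable_sum_log S)]
  refine measureReal_congr ?_
  filter_upwards [hU.ae_good] with ω ⟨_, he⟩
  have h0 : ∀ k, 0 < ε k ω := fun k => zero_lt_one.trans_le (he k)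
  refine propext ?_
  change ∏ k ∈ S, ε k ω ≤ x ↔ ∑ k ∈ S, Real.log (ε k ω) ≤ Real.log x
  rw [← Real.log_prod fun k _ => (h0 k).ne',
    Real.log_le_log_iff (Finset.prod_pos fun k _ => h0 k) hx]

omit [Fintype V] [DecidableEq V] in
theorem IsRecursiveML.isRegularlyVaryingAtZero_sum (hU : IsRecursiveML P D C Z ε U)
    (hα : ∀ i, IsRegularlyVaryingAtZero P (fun ω => Real.log (ε i ω)) α) {S : Finset V}
    (hS : S.Nonempty) :
    IsRegularlyVaryingAtZero P (fun ω => ∑ k ∈ S, Real.log (ε k ω)) (S.card * α) :=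
  IsRegularlyVaryingAtZero.finsetSum (Y := fun k ω => Real.log (ε k ω))
    (fun k => (hU.measurable_ε k).log)
    (hU.indep_ε.comp (fun _ => Real.log) fun _ => Real.measurable_log) hα hS

omit [Fintype V] [DecidableEq V] in
theorem IsRecursiveML.nullSingletonClass_sum (hU : IsRecursiveML P D C Z ε U)
    {S : Finset V} (hS : S.Nonempty) :
    NullSingletonClass (P.map fun ω => ∑ k ∈ S, Real.log (ε k ω)) := by
  refine nullSingletonClass_map_finsetSum (Y := fun k ω => Real.log (ε k ω))
    (fun k => (hU.measurable_ε k).log)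
    (hU.indep_ε.comp (fun _ => Real.log) fun _ => Real.measurable_log) (fun k => ?_) hS
  rw [nullSingletonClass_map_iff (hU.measurable_ε k).log]
  intro c
  refine measure_mono_null_ae ?_
    ((nullSingletonClass_map_iff (hU.measurable_ε k)).1 (hU.ε_noAtoms k) (Real.exp c))
  filter_upwards [hU.one_le_ε k] with ω hω h
  change ε k ω = Real.exp c
  rw [← show Real.log (ε k ω) = c from h, Real.exp_log (by linarith)]

omit [DecidableEq V] in
theorem IsRecursiveML.real_prod_le_pos (hU : IsRecursiveML P D C Z ε U)
    (hα : ∀ i, IsRegularlyVaryingAtZero P (fun ω => Real.log (ε i ω)) α) {S : Finset V}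
    (hS : S.Nonempty) {x : ℝ} (hx : 1 < x) : 0 < P.real {ω | ∏ k ∈ S, ε k ω ≤ x} := by
  rw [hU.real_prod_le S (by linarith)]
  exact (hU.isRegularlyVaryingAtZero_sum hα hS).cdf_pos (Real.log_pos hx)

/-- Right continuity suffices, which matters because the masked ratio, to which this is applied, can
have an atom at b. -/
theorem tendsto_real_le_mul {Y : Ω → ℝ} (hY : Measurable Y) {b : ℝ} (hb : 0 < b) :
    Tendsto (fun x => P.real {ω | Y ω ≤ b * x}) (𝓝[>] 1) (𝓝 (P.real {ω | Y ω ≤ b})) := by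
  have h := (cdf (P.map Y)).right_continuous b
  have hm : Tendsto (fun x : ℝ => b * x) (𝓝[>] 1) (𝓝[≥] b) := by
    refine tendsto_nhdsWithin_iff.2 ⟨?_, ?_⟩
    · have : Tendsto (fun x : ℝ => b * x) (𝓝 1) (𝓝 (b * 1)) := tendsto_id.const_mul b
      rw [mul_one] at this
      exact this.mono_left nhdsWithin_le_nhds
    · filter_upwards [self_mem_nhdsWithin] with x hx
      exact le_mul_of_one_le_right hb.le (le_of_lt hx)
  have := h.tendsto.comp hm
  rw [cdf_map_eq hY] at this
  exact this.congr fun x => cdf_map_eq hY _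

theorem IsRecursiveML.real_ratio_le_le (hU : IsRecursiveML P D C Z ε U)
    (hp : IsPath D j i (j :: t)) (x : ℝ) :
    P.real {ω | U i ω / U j ω ≤ pathWeight C (j :: t) * x} ≤
      P.real {ω | ∏ k ∈ t.toFinset, ε k ω ≤ x} *
        P.real {ω | maskedRatio D C Z ε t.toFinset j i ω ≤ pathWeight C (j :: t) * x} := by
  refine le_trans (real_mono_ae ?_) (IndepFun.real_inter
    (hU.indepFun_maskedRatio t.toFinset j i) (measurableSet_Iic (a := x))
    (measurableSet_Iic (a := pathWeight C (j :: t) * x))).le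
  filter_upwards [hU.ae_ratio hp] with ω ⟨h1, h2, _, _⟩ h
  exact ⟨le_of_mul_le_mul_left (h1.trans h) (hp.pathWeight_pos hU.weights), h2.trans h⟩

theorem IsRecursiveML.le_real_prod_le_and (hU : IsRecursiveML P D C Z ε U)
    (hp : IsPath D j i (j :: t)) (x : ℝ) :
    P.real {ω | maskedRatio D C Z ε t.toFinset j i ω ≤ pathWeight C (j :: t)} *
      P.real {ω | ∏ k ∈ t.toFinset, ε k ω ≤ x} ≤
      P.real {ω | ∏ k ∈ t.toFinset, ε k ω ≤ x ∧
        U i ω / U j ω = pathWeight C (j :: t) * ∏ k ∈ t.toFinset, ε k ω} := by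
  rw [mul_comm]
  refine le_trans (IndepFun.real_inter
    (hU.indepFun_maskedRatio t.toFinset j i) (measurableSet_Iic (a := x))
    (measurableSet_Iic (a := pathWeight C (j :: t)))).ge (real_mono_ae ?_)
  filter_upwards [hU.ae_ratio hp] with ω ⟨h1, _, h3, h4⟩ ⟨h5, h6⟩
  refine ⟨h5, le_antisymm (h3.trans ?_) h1⟩
  rw [mul_comm]
  exact mul_le_mul_of_nonneg_right h6 (zero_le_one.trans h4)

omit [Fintype V] in
theorem real_prod_le_and_le (hC : 0 < pathWeight C (j :: t)) (x : ℝ) :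
    P.real {ω | ∏ k ∈ t.toFinset, ε k ω ≤ x ∧
        U i ω / U j ω = pathWeight C (j :: t) * ∏ k ∈ t.toFinset, ε k ω} ≤
      P.real {ω | U i ω / U j ω ≤ pathWeight C (j :: t) * x} := by
  refine measureReal_mono fun ω ⟨h1, h2⟩ => ?_
  change U i ω / U j ω ≤ _
  rw [h2]
  exact mul_le_mul_of_nonneg_left h1 hC.le

theorem IsRecursiveML.isEquivalent_ratio (hU : IsRecursiveML P D C Z ε U)
    (hα : ∀ i, IsRegularlyVaryingAtZero P (fun ω => Real.log (ε i ω)) α) (hG : IsGeneric D C)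
    (hp : IsCriticalPath D C j i (j :: t)) (ht : t.toFinset.Nonempty) :
    Asymptotics.IsEquivalent (𝓝[>] 1)
      (fun x : ℝ => P.real {ω | U i ω / U j ω ≤ pathWeight C (j :: t) * x})
      (fun x : ℝ => P.real {ω | maskedRatio D C Z ε t.toFinset j i ω ≤ pathWeight C (j :: t)} *
        P.real {ω | ∏ k ∈ t.toFinset, ε k ω ≤ x}) := by
  refine isEquivalent_of_le_of_le (hU.real_maskedRatio_le_pos hα hG hp) ?_
    (tendsto_real_le_mul (hU.measurable_maskedRatio t.toFinset j i)
      (hp.1.pathWeight_pos hU.weights))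
    (Eventually.of_forall fun x => (hU.le_real_prod_le_and hp.1 x).trans
      (real_prod_le_and_le (hp.1.pathWeight_pos hU.weights) x))
    (Eventually.of_forall fun x => hU.real_ratio_le_le hp.1 x)
  filter_upwards [self_mem_nhdsWithin] with x hx using hU.real_prod_le_pos hα ht hx

theorem IsRecursiveML.isEquivalent_prod (hU : IsRecursiveML P D C Z ε U)
    (hα : ∀ i, IsRegularlyVaryingAtZero P (fun ω => Real.log (ε i ω)) α) (hG : IsGeneric D C)
    (hp : IsCriticalPath D C j i (j :: t)) (ht : t.toFinset.Nonempty) :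
    Asymptotics.IsEquivalent (𝓝[>] 1)
      (fun x : ℝ => P.real {ω | ∏ k ∈ t.toFinset, ε k ω ≤ x ∧
        U i ω / U j ω = pathWeight C (j :: t) * ∏ k ∈ t.toFinset, ε k ω})
      (fun x : ℝ => P.real {ω | maskedRatio D C Z ε t.toFinset j i ω ≤ pathWeight C (j :: t)} *
        P.real {ω | ∏ k ∈ t.toFinset, ε k ω ≤ x}) := by
  refine isEquivalent_of_le_of_le (hU.real_maskedRatio_le_pos hα hG hp) ?_
    (tendsto_real_le_mul (hU.measurable_maskedRatio t.toFinset j i)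
      (hp.1.pathWeight_pos hU.weights))
    (Eventually.of_forall fun x => hU.le_real_prod_le_and hp.1 x)
    (Eventually.of_forall fun x =>
      (real_prod_le_and_le (hp.1.pathWeight_pos hU.weights) x).trans (hU.real_ratio_le_le hp.1 x))
  filter_upwards [self_mem_nhdsWithin] with x hx using hU.real_prod_le_pos hα ht hx

section Sequences

variable {a : ℕ → ℝ} {x : ℝ}

theorem tendsto_one_add_mul (ha : Tendsto a atTop (𝓝[>] 0)) (hx : 0 < x) :
    Tendsto (fun n => 1 + a n * x) atTop (𝓝[>] 1) := by
  rw [tendsto_nhdsWithin_iff] at ha ⊢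
  constructor
  · simpa using (ha.1.mul_const x).const_add 1
  · filter_upwards [ha.2] with n hn
    exact lt_add_of_pos_right _ (mul_pos hn hx)

/-- Passes from products near 1 to sums of logarithms near 0, through log(1 + y) ~ y. -/
theorem tendsto_log_one_add_div (ha : Tendsto a atTop (𝓝[>] 0)) (hx : 0 < x) {q : ℕ → ℝ}
    (hq : Tendsto (fun n => a n / q n) atTop (𝓝 1)) :
    Tendsto (fun n => Real.log (1 + a n * x) / q n) atTop (𝓝 x) := by
  have h1 : Tendsto (fun y : ℝ => y⁻¹ * Real.log (1 + y)) (𝓝[≠] 0) (𝓝 1) := by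
    have := (Real.hasDerivAt_log one_ne_zero).tendsto_slope_zero
    simpa using this
  have h2 : Tendsto (fun n => a n * x) atTop (𝓝[≠] 0) := by
    rw [tendsto_nhdsWithin_iff] at ha ⊢
    refine ⟨by simpa using ha.1.mul_const x, ?_⟩
    filter_upwards [ha.2] with n hn
    exact (mul_pos hn hx).ne'
  have h3 := (h1.comp h2).mul (hq.mul_const x)
  rw [one_mul, one_mul] at h3
  refine h3.congr' ?_
  filter_upwards [ha.eventually self_mem_nhdsWithin] with n hn
  have : a n ≠ 0 := ne_of_gt hn
  simp only [Function.comp]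
  field_simp

end Sequences

omit [Fintype V] [DecidableEq V] in
theorem IsRecursiveML.tendsto_normalization (hU : IsRecursiveML P D C Z ε U)
    (hα : ∀ i, IsRegularlyVaryingAtZero P (fun ω => Real.log (ε i ω)) α) {S : Finset V}
    (hS : S.Nonempty) {a : ℕ → ℝ}
    (ha : Asymptotics.IsEquivalent atTop a (fun n : ℕ => quantile
      (P.map fun ω => ∑ k ∈ S, Real.log (ε k ω)) (1 / (n : ℝ)))) :
    Tendsto a atTop (𝓝[>] 0) ∧ Tendsto (fun n : ℕ => a n / quantile
      (P.map fun ω => ∑ k ∈ S, Real.log (ε k ω)) (1 / (n : ℝ))) atTop (𝓝 1) := by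
  have := hU.nullSingletonClass_sum hS
  have hq := (hU.isRegularlyVaryingAtZero_sum hα hS).tendsto_quantile (hU.measurable_sum_log S)
  have hq0 := hq.eventually self_mem_nhdsWithin
  have h1 := (Asymptotics.isEquivalent_iff_tendsto_one
    (hq0.mono fun n hn => ne_of_gt hn)).1 ha
  refine ⟨tendsto_nhdsWithin_iff.2
    ⟨ha.symm.tendsto_nhds (tendsto_nhdsWithin_iff.1 hq).1, ?_⟩, h1⟩
  filter_upwards [hq0, h1.eventually (lt_mem_nhds one_pos)] with n h2 h3
  exact (div_pos_iff_of_pos_right h2).1 h3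

omit [DecidableEq V] in
theorem IsRecursiveML.tendsto_nat_mul_prod (hU : IsRecursiveML P D C Z ε U)
    (hα : ∀ i, IsRegularlyVaryingAtZero P (fun ω => Real.log (ε i ω)) α) {S : Finset V}
    (hS : S.Nonempty) {a : ℕ → ℝ}
    (ha : Asymptotics.IsEquivalent atTop a (fun n : ℕ => quantile
      (P.map fun ω => ∑ k ∈ S, Real.log (ε k ω)) (1 / (n : ℝ)))) {x : ℝ} (hx : 0 < x) :
    Tendsto (fun n : ℕ => n * P.real {ω | ∏ k ∈ S, ε k ω ≤ 1 + a n * x}) atTop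
      (𝓝 (x ^ (S.card * α))) := by
  have := hU.nullSingletonClass_sum hS
  obtain ⟨h1, h2⟩ := hU.tendsto_normalization hα hS ha
  refine ((hU.isRegularlyVaryingAtZero_sum hα hS).tendsto_nat_mul_cdf
    (hU.measurable_sum_log S) hx (tendsto_log_one_add_div h1 hx h2)).congr' ?_
  filter_upwards [h1.eventually self_mem_nhdsWithin] with n hn
  rw [hU.real_prod_le S (add_pos one_pos (mul_pos hn hx))]

theorem IsRecursiveML.tendsto_nat_mul_ratio (hU : IsRecursiveML P D C Z ε U)
    (hα : ∀ i, IsRegularlyVaryingAtZero P (fun ω => Real.log (ε i ω)) α) (hG : IsGeneric D C)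
    (hp : IsCriticalPath D C j i (j :: t)) (ht : t.toFinset.Nonempty) {a : ℕ → ℝ}
    (ha : Asymptotics.IsEquivalent atTop a (fun n : ℕ => quantile
      (P.map fun ω => ∑ k ∈ t.toFinset, Real.log (ε k ω)) (1 / (n : ℝ)))) {x : ℝ}
    (hx : 0 < x) :
    Tendsto (fun n : ℕ => n * P.real {ω | U i ω / U j ω ≤
        pathWeight C (j :: t) * (1 + a n * x)}) atTop
      (𝓝 (P.real {ω | maskedRatio D C Z ε t.toFinset j i ω ≤ pathWeight C (j :: t)} *
        x ^ (t.toFinset.card * α))) := by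
  have h1 := (hU.isEquivalent_ratio hα hG hp ht).comp_tendsto
    (tendsto_one_add_mul (hU.tendsto_normalization hα ht ha).1 hx)
  have h2 := (Asymptotics.IsEquivalent.refl (u := fun n : ℕ => (n : ℝ)) (l := atTop)).mul h1
  refine h2.symm.tendsto_nhds (((hU.tendsto_nat_mul_prod hα ht ha hx).const_mul
    (P.real {ω | maskedRatio D C Z ε t.toFinset j i ω ≤ pathWeight C (j :: t)})).congr fun n => ?_)
  simp only [Pi.mul_apply, Function.comp]
  ring

/-! ### Ratios of different pairs -/

/-- The noise at j' factors out of the value at j' and does not influence the value at j. Equality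
would thus make this atom-free variable a function of variables independent of it. -/
theorem IsRecursiveML.measure_solution_eq_of_not_reflTransGen (hU : IsRecursiveML P D C Z ε U)
    {j j' : V} (h : ¬ Relation.ReflTransGen D.Adj j' j) (c : ℝ) :
    P {ω | solution D C (fun k => Z k ω) (fun k => ε k ω) j' =
      c * solution D C (fun k => Z k ω) (fun k => ε k ω) j} = 0 := by
  have hind := hU.indepFun_mask {j'}
  simp only [Finset.prod_singleton] at hind
  have h0 := measure_eq_zero_of_indepFun (hU.measurable_ε j') (hU.measurable_noise {j'}) hind
    (hU.ε_noAtoms j')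
    (((measurable_solution D C j).const_mul c).div (measurable_solution D C j'))
  refine measure_mono_null_ae ?_ h0
  filter_upwards [hU.ae_good] with ω ⟨hz, he⟩ h1
  replace h1 : solution D C (fun k => Z k ω) (fun k => ε k ω) j' =
      c * solution D C (fun k => Z k ω) (fun k => ε k ω) j := h1
  change ε j' ω = c * solution D C (fun k => Z k ω) (mask {j'} fun k => ε k ω) j /
    solution D C (fun k => Z k ω) (mask {j'} fun k => ε k ω) j'
  have hpos : 0 < solution D C (fun k => Z k ω) (mask {j'} fun k => ε k ω) j' :=
    solution_pos hU.isDAG hz (fun k => zero_lt_one.trans_le (one_le_mask he k)) j'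
  rw [eq_div_iff hpos.ne', ← solution_eq_mul_mask (e := fun k => ε k ω)
    (zero_le_one.trans (he j')), h1]
  congr 1
  refine solution_congr fun k hk => (mask_of_notMem (e := fun k => ε k ω) ?_).symm
  rw [Finset.mem_singleton]
  rintro rfl
  exact h hk

/-- Two distinct nodes of a DAG cannot reach each other, so the preceding lemma applies in one of
the two orders. -/
theorem IsRecursiveML.measure_solution_eq (hU : IsRecursiveML P D C Z ε U)
    {j j' : V} (hj : j ≠ j') (c : ℝ) :
    P {ω | solution D C (fun k => Z k ω) (fun k => ε k ω) j' =
      c * solution D C (fun k => Z k ω) (fun k => ε k ω) j} = 0 := by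
  by_cases h : Relation.ReflTransGen D.Adj j' j
  · have h' : ¬ Relation.ReflTransGen D.Adj j j' := by
      intro h2
      rcases Relation.reflTransGen_iff_eq_or_transGen.1 h with h3 | h3
      · exact hj h3
      · exact hU.isDAG _ (h3.trans_left h2)
    refine measure_mono_null_ae ?_ (hU.measure_solution_eq_of_not_reflTransGen h' c⁻¹)
    filter_upwards [hU.ae_good] with ω ⟨hz, he⟩ h1
    replace h1 : solution D C (fun k => Z k ω) (fun k => ε k ω) j' =
      c * solution D C (fun k => Z k ω) (fun k => ε k ω) j := h1
    have hpos : 0 < solution D C (fun k => Z k ω) (fun k => ε k ω) j' :=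
      solution_pos hU.isDAG hz (fun k => zero_lt_one.trans_le (he k)) j'
    have hc : c ≠ 0 := by
      rintro rfl
      rw [zero_mul] at h1
      exact hpos.ne' h1
    change solution D C (fun k => Z k ω) (fun k => ε k ω) j = c⁻¹ * _
    rw [h1, inv_mul_cancel_left₀ hc]
  · exact hU.measure_solution_eq_of_not_reflTransGen h c

theorem tendsto_real_mem_Icc {Y : Ω → ℝ} (hY : Measurable Y) [NullSingletonClass (P.map Y)]
    {u v : ℕ → ℝ} {c : ℝ} (hu : Tendsto u atTop (𝓝 c)) (hv : Tendsto v atTop (𝓝 c))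
    (huv : ∀ᶠ n in atTop, u n ≤ v n) :
    Tendsto (fun n => P.real {ω | Y ω ∈ Set.Icc (u n) (v n)}) atTop (𝓝 0) := by
  have := Measure.isProbabilityMeasure_map (μ := P) hY.aemeasurable
  have hc := continuous_cdf_of_nullSingletonClass (P.map Y)
  have h := ((hc.tendsto c).comp hv).sub ((hc.tendsto c).comp hu)
  rw [sub_self] at h
  refine h.congr' ?_
  filter_upwards [huv] with n hn
  rw [Function.comp, Function.comp, ← real_Ioc_eq hY hn]
  refine measureReal_congr ?_
  have h0 := (nullSingletonClass_map_iff hY).1 ‹_› (u n)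
  rw [measure_eq_zero_iff_ae_notMem] at h0
  filter_upwards [h0] with ω hω
  refine propext ⟨fun h => ⟨h.1.le, h.2⟩, fun h => ⟨lt_of_le_of_ne h.1 fun h' => hω h'.symm, h.2⟩⟩

theorem tendsto_nat_mul_of_le {f g w : ℕ → ℝ} {L : ℝ} (hf : ∀ n, 0 ≤ f n)
    (hfg : ∀ᶠ n in atTop, f n ≤ g n * w n) (hg : Tendsto (fun n : ℕ => n * g n) atTop (𝓝 L))
    (hw : Tendsto w atTop (𝓝 0)) : Tendsto (fun n : ℕ => n * f n) atTop (𝓝 0) := by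
  have h := hg.mul hw
  rw [mul_zero] at h
  refine tendsto_of_tendsto_of_tendsto_of_le_of_le' tendsto_const_nhds h
    (Eventually.of_forall fun n => mul_nonneg n.cast_nonneg (hf n)) ?_
  filter_upwards [hfg] with n hn
  rw [mul_assoc]
  exact mul_le_mul_of_nonneg_left hn n.cast_nonneg

variable {j' i' : V} {t' : List V} {y y' : ℕ → ℝ} {L L' : ℝ}

/-- The second ratio near its bound forces ε k into [1, y' n], an event of vanishing probability
that is independent of the first product because k lies outside it. -/
theorem IsRecursiveML.tendsto_pair_of_mem (hU : IsRecursiveML P D C Z ε U)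
    (hp : IsPath D j i (j :: t)) (hp' : IsPath D j' i' (j' :: t'))
    (hL : Tendsto (fun n : ℕ => n * P.real {ω | ∏ k ∈ t.toFinset, ε k ω ≤ y n}) atTop (𝓝 L))
    (hy' : Tendsto y' atTop (𝓝[>] 1)) {k : V} (hk' : k ∈ t'.toFinset) (hk : k ∉ t.toFinset) :
    Tendsto (fun n : ℕ => n * P.real {ω | U i ω / U j ω ≤ pathWeight C (j :: t) * y n ∧
      U i' ω / U j' ω ≤ pathWeight C (j' :: t') * y' n}) atTop (𝓝 0) := by
  have hind : IndepFun (fun ω => ∏ k ∈ t.toFinset, ε k ω) (ε k) P := by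
    have := hU.indep_ε.indepFun_finsetProd_of_notMem hU.measurable_ε hk
    convert this using 1
    ext ω
    simp
  have := hU.ε_noAtoms k
  have hy1 := tendsto_nhdsWithin_iff.1 hy'
  refine tendsto_nat_mul_of_le (w := fun n => P.real {ω | ε k ω ∈ Set.Icc 1 (y' n)})
    (fun n => measureReal_nonneg) (Eventually.of_forall fun n => ?_) hL
    (tendsto_real_mem_Icc (hU.measurable_ε k) tendsto_const_nhds hy1.1
      (hy1.2.mono fun n hn => le_of_lt hn))
  refine le_trans (real_mono_ae ?_) (IndepFun.real_inter hind (measurableSet_Iic (a := y n))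
    (measurableSet_Icc (a := 1) (b := y' n))).le
  filter_upwards [hU.ae_ratio hp, hU.ae_ratio hp', hU.ae_good] with ω ⟨h1, _⟩ ⟨h1', _⟩ ⟨_, he⟩
    ⟨h2, h2'⟩
  refine ⟨le_of_mul_le_mul_left (h1.trans h2) (hp.pathWeight_pos hU.weights), he k, ?_⟩
  refine le_trans ?_ (le_of_mul_le_mul_left (h1'.trans h2') (hp'.pathWeight_pos hU.weights))
  rw [← Finset.mul_prod_erase _ _ hk']
  exact le_mul_of_one_le_right (zero_le_one.trans (he k)) (Finset.one_le_prod fun k _ => he k)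

/-- Both ratios near their bounds force U_{j'}/U_j into an interval shrinking to b/b'. The common
node set consists of proper descendants of j and of j', so this quotient is itself a masked ratio
and is independent of the product. -/
theorem IsRecursiveML.tendsto_pair_of_eq (hU : IsRecursiveML P D C Z ε U)
    (hp : IsPath D j i (j :: t)) (hp' : IsPath D j' i (j' :: t')) (hj : j ≠ j')
    (htt : t.toFinset = t'.toFinset)
    (hL : Tendsto (fun n : ℕ => n * P.real {ω | ∏ k ∈ t.toFinset, ε k ω ≤ y n}) atTop (𝓝 L))
    (hy : Tendsto y atTop (𝓝[>] 1)) (hy' : Tendsto y' atTop (𝓝[>] 1)) :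
    Tendsto (fun n : ℕ => n * P.real {ω | U i ω / U j ω ≤ pathWeight C (j :: t) * y n ∧
      U i ω / U j' ω ≤ pathWeight C (j' :: t') * y' n}) atTop (𝓝 0) := by
  set b := pathWeight C (j :: t) with hb
  set b' := pathWeight C (j' :: t') with hb'
  have hb0 : 0 < b := hp.pathWeight_pos hU.weights
  have hb0' : 0 < b' := hp'.pathWeight_pos hU.weights
  have hm : ∀ᵐ ω ∂P, maskedRatio D C Z ε t.toFinset j j' ω = U j' ω / U j ω ∧ 0 < U j ω ∧
      0 < U j' ω := by
    filter_upwards [hU.ae_eq_solution, hU.ae_good] with ω h ⟨hz, he⟩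
    rw [maskedRatio, solution_mask hU.isDAG fun k hk =>
      hp.transGen_of_mem_tail (List.mem_toFinset.1 hk), htt, solution_mask hU.isDAG fun k hk =>
      hp'.transGen_of_mem_tail (List.mem_toFinset.1 hk), h, h]
    have he0 : ∀ k, 0 < ε k ω := fun k => zero_lt_one.trans_le (he k)
    exact ⟨rfl, solution_pos hU.isDAG hz he0 _, solution_pos hU.isDAG hz he0 _⟩
  have hna : NullSingletonClass (P.map (maskedRatio D C Z ε t.toFinset j j')) := by
    rw [nullSingletonClass_map_iff (hU.measurable_maskedRatio _ _ _)]
    intro c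
    refine measure_mono_null_ae ?_ (hU.measure_solution_eq hj c)
    filter_upwards [hm, hU.ae_eq_solution] with ω ⟨h1, h2, h3⟩ h4 h
    replace h : maskedRatio D C Z ε t.toFinset j j' ω = c := h
    rw [h1, div_eq_iff h2.ne', h4, h4] at h
    exact h
  have hy1 := tendsto_nhdsWithin_iff.1 hy
  have hy1' := tendsto_nhdsWithin_iff.1 hy'
  have hlo : Tendsto (fun n => b / (b' * y' n)) atTop (𝓝 (b / b')) := by
    have := (tendsto_const_nhds (x := b)).div (hy1'.1.const_mul b') (by simpa using hb0'.ne')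
    rwa [mul_one] at this
  have hup : Tendsto (fun n => b * y n / b') atTop (𝓝 (b / b')) := by
    have := (hy1.1.const_mul b).div_const b'
    simpa using this
  refine tendsto_nat_mul_of_le
    (w := fun n => P.real {ω | maskedRatio D C Z ε t.toFinset j j' ω ∈
      Set.Icc (b / (b' * y' n)) (b * y n / b')})
    (fun n => measureReal_nonneg) ?_ hL
    (tendsto_real_mem_Icc (hU.measurable_maskedRatio _ _ _) hlo hup ?_)
  · filter_upwards [hy1'.2] with n hn
    have hyn : 0 < y' n := zero_lt_one.trans hn
    refine le_trans (real_mono_ae ?_) (IndepFun.real_inter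
      (hU.indepFun_maskedRatio t.toFinset j j') (measurableSet_Iic (a := y n))
      (measurableSet_Icc (a := b / (b' * y' n)) (b := b * y n / b'))).le
    filter_upwards [hU.ae_ratio hp, hU.ae_ratio hp', hm] with ω ⟨h1, _, _, h3⟩ ⟨h1', _, _, h3'⟩
      ⟨hr, hj0, hj0'⟩ ⟨h2, h2'⟩
    refine ⟨le_of_mul_le_mul_left (h1.trans h2) hb0, ?_⟩
    have h4 : b ≤ U i ω / U j ω := (le_mul_of_one_le_right hb0.le h3).trans h1
    have h4' : b' ≤ U i ω / U j' ω := (le_mul_of_one_le_right hb0'.le h3').trans h1'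
    rw [le_div_iff₀ hj0] at h4
    rw [le_div_iff₀ hj0'] at h4'
    rw [div_le_iff₀ hj0] at h2
    rw [div_le_iff₀ hj0'] at h2'
    rw [hr]
    constructor
    · rw [div_le_div_iff₀ (by positivity) hj0]
      linarith
    · rw [div_le_div_iff₀ hj0 hb0']
      linarith
  · filter_upwards [hy1.2, hy1'.2] with n h1 h2
    have h1' : 1 < y n := h1
    have h2' : 1 < y' n := h2
    calc b / (b' * y' n) ≤ b / b' := by
          refine div_le_div_of_nonneg_left hb0.le hb0' ?_
          exact le_mul_of_one_le_right hb0'.le h2'.le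
      _ ≤ b * y n / b' := by
          refine div_le_div_of_nonneg_right ?_ hb0'.le
          exact le_mul_of_one_le_right hb0.le h1'.le

/-- Two different ratios are not simultaneously close to their lower bounds. -/
theorem IsRecursiveML.tendsto_pair (hU : IsRecursiveML P D C Z ε U)
    (hp : IsPath D j i (j :: t)) (hp' : IsPath D j' i' (j' :: t')) (hji : j ≠ i)
    (hji' : j' ≠ i') (hne : (j, i) ≠ (j', i'))
    (hL : Tendsto (fun n : ℕ => n * P.real {ω | ∏ k ∈ t.toFinset, ε k ω ≤ y n}) atTop (𝓝 L))
    (hL' : Tendsto (fun n : ℕ => n * P.real {ω | ∏ k ∈ t'.toFinset, ε k ω ≤ y' n}) atTop (𝓝 L'))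
    (hy : Tendsto y atTop (𝓝[>] 1)) (hy' : Tendsto y' atTop (𝓝[>] 1)) :
    Tendsto (fun n : ℕ => n * P.real {ω | U i ω / U j ω ≤ pathWeight C (j :: t) * y n ∧
      U i' ω / U j' ω ≤ pathWeight C (j' :: t') * y' n}) atTop (𝓝 0) := by
  by_cases h : t'.toFinset ⊆ t.toFinset
  · by_cases h' : t.toFinset ⊆ t'.toFinset
    · have htt := h'.antisymm h
      -- Each end node lies on the other path and so reaches its end; acyclicity makes them equal.
      obtain rfl : i = i' := by
        have h1 : Relation.ReflTransGen D.Adj i i' := hp'.reflTransGen_of_mem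
          (List.mem_cons_of_mem _ (List.mem_toFinset.1 (h' (List.mem_toFinset.2
            (hp.last_mem_tail hji)))))
        have h2 : Relation.ReflTransGen D.Adj i' i := hp.reflTransGen_of_mem
          (List.mem_cons_of_mem _ (List.mem_toFinset.1 (h (List.mem_toFinset.2
            (hp'.last_mem_tail hji')))))
        rcases Relation.reflTransGen_iff_eq_or_transGen.1 h1 with h3 | h3
        · exact h3.symm
        · exact absurd (h3.trans_left h2) (hU.isDAG _)
      exact hU.tendsto_pair_of_eq hp hp' (fun h => hne (by rw [h])) htt hL hy hy'
    · obtain ⟨k, hk, hk'⟩ := Finset.not_subset.1 h'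
      refine (hU.tendsto_pair_of_mem hp' hp hL' hy hk hk').congr fun n => ?_
      simp only [and_comm]
  · obtain ⟨k, hk, hk'⟩ := Finset.not_subset.1 h
    exact hU.tendsto_pair_of_mem hp hp' hL hy' hk hk'

end Asymptotics

theorem mem_positivePairs {V : Type*} [Fintype V] {D : Digraph V} {C : Matrix V V ℝ}
    {q : V × V} : q ∈ positivePairs D C ↔ q.1 ≠ q.2 ∧ 0 < mlCoeff D C q.1 q.2 := by
  simp [positivePairs]

/-! ### Limits of unions and inclusion-exclusion. -/

section Limits

/-- If the pairwise intersections are asymptotically negligible, the probability of a finite union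
is asymptotically the sum of the probabilities. -/
theorem tendsto_nat_mul_real_biUnion {Ω ι : Type*} [MeasurableSpace Ω] {P : Measure Ω}
    [IsFiniteMeasure P] (T : Finset ι) (A : ι → ℕ → Set Ω) (lam : ι → ℝ)
    (hA : ∀ q ∈ T, ∀ n, NullMeasurableSet (A q n) P)
    (h1 : ∀ q ∈ T, Tendsto (fun n : ℕ => n * P.real (A q n)) atTop (𝓝 (lam q)))
    (h2 : ∀ q ∈ T, ∀ r ∈ T, q ≠ r →
      Tendsto (fun n : ℕ => n * P.real (A q n ∩ A r n)) atTop (𝓝 0)) :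
    Tendsto (fun n : ℕ => n * P.real (⋃ q ∈ T, A q n)) atTop (𝓝 (∑ q ∈ T, lam q)) := by
  classical
  induction T using Finset.induction_on with
  | empty => simp
  | insert q T hq ih =>
    have ih' := ih (fun r hr => hA r (Finset.mem_insert_of_mem hr))
      (fun r hr => h1 r (Finset.mem_insert_of_mem hr))
      (fun r hr s hs => h2 r (Finset.mem_insert_of_mem hr) s (Finset.mem_insert_of_mem hs))
    have h3 : Tendsto (fun n : ℕ => n * P.real (A q n ∩ ⋃ r ∈ T, A r n)) atTop (𝓝 0) := by
      have hs : Tendsto (fun n : ℕ => ∑ r ∈ T, n * P.real (A q n ∩ A r n)) atTop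
          (𝓝 (∑ _r ∈ T, 0)) := tendsto_finsetSum _ fun r hr =>
        h2 q (Finset.mem_insert_self _ _) r (Finset.mem_insert_of_mem hr) fun h => hq (h ▸ hr)
      rw [Finset.sum_const_zero] at hs
      refine tendsto_of_tendsto_of_tendsto_of_le_of_le tendsto_const_nhds hs
        (fun n => by positivity) fun n => ?_
      dsimp only
      rw [← Finset.mul_sum, Set.inter_iUnion₂]
      exact mul_le_mul_of_nonneg_left (measureReal_biUnion_finset_le _ _) n.cast_nonneg
    have h4 := ((h1 q (Finset.mem_insert_self _ _)).add ih').sub h3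
    rw [sub_zero, ← Finset.sum_insert hq] at h4
    refine h4.congr fun n => ?_
    rw [Finset.set_biUnion_insert]
    have := measureReal_union_add_inter₀' (μ := P) (t := ⋃ r ∈ T, A r n)
      (hA q (Finset.mem_insert_self _ _) n) (measure_ne_top _ _) (measure_ne_top _ _)
    linear_combination (-(n : ℝ)) * this

/-- The limits of the joint probabilities of the complements determine those of the events. -/
theorem tendsto_real_forall_mem {Ω ι : Type*} [MeasurableSpace Ω] {P : Measure Ω}
    [IsFiniteMeasure P] (R : Finset ι) (E : ι → ℕ → Set Ω) (s : ι → ℝ)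
    (hE : ∀ q ∈ R, ∀ n, NullMeasurableSet (E q n) P)
    (h : ∀ T ⊆ R, Tendsto (fun n => P.real {ω | ∀ q ∈ T, ω ∉ E q n}) atTop (𝓝 (∏ q ∈ T, s q))) :
    Tendsto (fun n => P.real {ω | ∀ q ∈ R, ω ∈ E q n}) atTop (𝓝 (∏ q ∈ R, (1 - s q))) := by
  classical
  -- The generalisation to mixed events makes induction possible: requiring E q as well subtracts
  -- the probability in which q joins A.
  have key : ∀ B ⊆ R, ∀ A ⊆ R, Disjoint A B →
      Tendsto (fun n => P.real {ω | (∀ q ∈ A, ω ∉ E q n) ∧ ∀ q ∈ B, ω ∈ E q n}) atTop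
        (𝓝 ((∏ q ∈ A, s q) * ∏ q ∈ B, (1 - s q))) := by
    intro B
    induction B using Finset.induction_on with
    | empty =>
      intro _ A hA _
      simpa using h A hA
    | insert q B hq ih =>
      intro hB A hA hAB
      rw [Finset.disjoint_insert_right] at hAB
      have hqR := hB (Finset.mem_insert_self _ _)
      have hBR := (Finset.subset_insert q B).trans hB
      have h1 := ih hBR A hA hAB.2
      have h2 := ih hBR (insert q A) (Finset.insert_subset hqR hA)
        (Finset.disjoint_insert_left.2 ⟨hq, hAB.2⟩)
      have h3 := h1.sub h2
      rw [Finset.prod_insert hAB.1] at h3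
      rw [Finset.prod_insert hq, show (∏ q ∈ A, s q) * ((1 - s q) * ∏ q ∈ B, (1 - s q)) =
        (∏ q ∈ A, s q) * (∏ q ∈ B, (1 - s q)) - s q * (∏ q ∈ A, s q) * ∏ q ∈ B, (1 - s q) by ring]
      refine h3.congr fun n => ?_
      rw [← measureReal_inter_add_sdiff₀ (s := {ω | (∀ q ∈ A, ω ∉ E q n) ∧ ∀ q ∈ B, ω ∈ E q n})
        (hE q hqR n)]
      rw [show {ω | (∀ r ∈ insert q A, ω ∉ E r n) ∧ ∀ q ∈ B, ω ∈ E q n} =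
        {ω | (∀ q ∈ A, ω ∉ E q n) ∧ ∀ q ∈ B, ω ∈ E q n} \ E q n by
          ext ω; simp only [Finset.forall_mem_insert, Set.mem_ofPred_eq, Set.mem_sdiff]; tauto,
        add_sub_cancel_right]
      congr 1
      ext ω
      simp only [Finset.forall_mem_insert, Set.mem_ofPred_eq, Set.mem_inter_iff]
      tauto
  simpa using key R subset_rfl ∅ (Finset.empty_subset _) (Finset.disjoint_empty_left _)

theorem weibullCDF_eq {κ c x : ℝ} (hκ : 0 < κ) (hc : 0 < c) (hx : 0 < x) :
    weibullCDF κ (c ^ (-(1 / κ))) x = 1 - Real.exp (-(c * x ^ κ)) := by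
  rw [weibullCDF, if_pos hx, Real.rpow_neg hc.le, div_inv_eq_mul,
    Real.mul_rpow hx.le (Real.rpow_nonneg hc.le _), ← Real.rpow_mul hc.le,
    one_div_mul_cancel hκ.ne', Real.rpow_one, mul_comm]

end Limits

/-! ### Sample minima of the ratios. -/

section Sample

variable {V Ω Ω' : Type*} [Fintype V] [MeasurableSpace Ω] {P : Measure Ω}
  [IsProbabilityMeasure P] [MeasurableSpace Ω'] {P' : Measure Ω'} [IsProbabilityMeasure P']
  {U : V → Ω → ℝ} {X : ℕ → Ω' → V → ℝ}

omit [Fintype V] in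
theorem measurableSet_forall_lt_div (T : Finset (V × V)) (u : V × V → ℝ) :
    MeasurableSet {v : V → ℝ | ∀ q ∈ T, u q < v q.2 / v q.1} := by
  have : {v : V → ℝ | ∀ q ∈ T, u q < v q.2 / v q.1} =
      ⋂ q ∈ T, {v : V → ℝ | u q < v q.2 / v q.1} := by
    ext; simp
  rw [this]
  exact Finset.measurableSet_biInter _ fun q _ => measurableSet_lt measurable_const
    ((measurable_pi_apply q.2).div (measurable_pi_apply q.1))

omit [Fintype V] [IsProbabilityMeasure P] in
theorem nullMeasurableSet_ratio_le {Y : V → Ω → ℝ} (hY : AEMeasurable (fun ω i => Y i ω) P)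
    (j i : V) (u : ℝ) : NullMeasurableSet {ω | Y i ω / Y j ω ≤ u} P :=
  hY.nullMeasurable (measurableSet_le ((measurable_pi_apply i).div (measurable_pi_apply j))
    measurable_const : MeasurableSet {v : V → ℝ | v i / v j ≤ u})

omit [Fintype V] [IsProbabilityMeasure P'] in
theorem IsIIDSample.real_forall_lt (hX : IsIIDSample P U P' X) (T : Finset (V × V))
    (u : V × V → ℝ) (n : ℕ) :
    P'.real {ω | ∀ q ∈ T, ω ∉ {ω | ∃ k : Fin n, X k ω q.2 / X k ω q.1 ≤ u q}} =
      (1 - P.real (⋃ q ∈ T, {ω | U q.2 ω / U q.1 ω ≤ u q})) ^ n := by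
  set B := {v : V → ℝ | ∀ q ∈ T, u q < v q.2 / v q.1}
  have hB : MeasurableSet B := measurableSet_forall_lt_div T u
  have h1 : {ω | ∀ q ∈ T, ω ∉ {ω | ∃ k : Fin n, X k ω q.2 / X k ω q.1 ≤ u q}} =
      ⋂ k ∈ Finset.range n, X k ⁻¹' B := by
    ext ω
    simp only [Set.mem_ofPred_eq, not_exists, not_le, Set.mem_iInter, Finset.mem_range,
      Set.mem_preimage, B]
    exact ⟨fun h k hk q hq => h q hq ⟨k, hk⟩, fun h q hq k => h k k.2 q hq⟩
  have h2 : ⋃ q ∈ T, {ω | U q.2 ω / U q.1 ω ≤ u q} = ((fun ω i => U i ω) ⁻¹' B)ᶜ := by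
    ext ω
    simp [B]
  rw [h1, h2, probReal_compl_eq_one_sub₀
    ((hX.ident 0).aemeasurable_snd.nullMeasurable hB), sub_sub_cancel, Measure.real,
    hX.indep.measure_inter_preimage_eq_mul _ fun _ _ => hB, ENNReal.toReal_prod]
  rw [Finset.prod_congr rfl fun k _ => congrArg ENNReal.toReal ((hX.ident k).measure_mem_eq hB)]
  simp [Measure.real]

omit [Fintype V] [MeasurableSpace Ω'] in
-- For n = 0 the infimum is the default value 0, so the equivalence would fail for u ≥ 0.
theorem minRatio_le_iff {n : ℕ} (hn : n ≠ 0) (j i : V) (ω : Ω') (u : ℝ) :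
    minRatio X n j i ω ≤ u ↔ ∃ k : Fin n, X k ω i / X k ω j ≤ u := by
  have : NeZero n := ⟨hn⟩
  constructor
  · intro h
    obtain ⟨k, hk⟩ := exists_eq_ciInf_of_finite (f := fun k : Fin n => X k ω i / X k ω j)
    exact ⟨k, hk.trans_le h⟩
  · rintro ⟨k, hk⟩
    exact (ciInf_le (Set.finite_range fun k : Fin n => X k ω i / X k ω j).bddBelow k).trans hk

theorem one_div_mul_sub_le_iff {a b m x : ℝ} (ha : 0 < a) (hb : 0 < b) :
    1 / (a * b) * (m - b) ≤ x ↔ m ≤ b * (1 + a * x) := by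
  rw [one_div, inv_mul_le_iff₀ (mul_pos ha hb)]
  constructor <;> intro h <;> linarith

end Sample

end MaxLinear

/-! ### Proof of the main theorem. -/

open MaxLinear in
theorem mainTheorem1 {V : Type*} [Fintype V] [DecidableEq V] {Ω : Type*} [MeasurableSpace Ω]
    (P : Measure Ω) [IsProbabilityMeasure P]
    (D : Digraph V) (C : Matrix V V ℝ) (Z ε U : V → Ω → ℝ) (α : ℝ)
    (hU : IsRecursiveML P D C Z ε U)
    (hC : IsGeneric D C)
    (hα : ∀ i, IsRegularlyVaryingAtZero P (fun ω => Real.log (ε i ω)) α)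
    (p : V → V → List V)
    (hp : ∀ q ∈ positivePairs D C, IsCriticalPath D C q.1 q.2 (p q.1 q.2)) :
    ∃ c : V → V → ℝ,
      (∀ q ∈ positivePairs D C,
        let j := q.1
        let i := q.2
        let b := mlCoeff D C j i
        let S := nodeSet (p j i)
        c j i ∈ Set.Ioo 0 1 ∧
        Asymptotics.IsEquivalent (𝓝[>] 1)
          (fun x : ℝ => P.real {ω | U i ω / U j ω ≤ b * x})
          (fun x : ℝ => P.real {ω | ∏ k ∈ S, ε k ω ≤ x ∧ U i ω / U j ω = b * ∏ k ∈ S, ε k ω}) ∧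
        Asymptotics.IsEquivalent (𝓝[>] 1)
          (fun x : ℝ => P.real {ω | U i ω / U j ω ≤ b * x})
          (fun x : ℝ => c j i * P.real {ω | ∏ k ∈ S, ε k ω ≤ x})) ∧
      ∀ (a : V → V → ℕ → ℝ),
        (∀ q ∈ positivePairs D C,
          Asymptotics.IsEquivalent atTop (a q.1 q.2)
            (fun n : ℕ => quantile
              (P.map fun ω => ∑ k ∈ nodeSet (p q.1 q.2), Real.log (ε k ω)) (1 / (n : ℝ)))) →
        ∀ {Ω' : Type*} [MeasurableSpace Ω'] (P' : Measure Ω') [IsProbabilityMeasure P']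
          (X : ℕ → Ω' → V → ℝ), IsIIDSample P U P' X →
        ∀ x : V → V → ℝ, (∀ q ∈ positivePairs D C, 0 < x q.1 q.2) →
          Tendsto
            (fun n : ℕ => P'.real {ω | ∀ q ∈ positivePairs D C,
              1 / (a q.1 q.2 n * mlCoeff D C q.1 q.2) *
                (minRatio X n q.1 q.2 ω - mlCoeff D C q.1 q.2) ≤ x q.1 q.2})
            atTop
            (𝓝 (∏ q ∈ positivePairs D C,
              weibullCDF (pathLength (p q.1 q.2) * α)
                (c q.1 q.2 ^ (-(1 / (pathLength (p q.1 q.2) * α)))) (x q.1 q.2))) := by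
  have hcons : ∀ q ∈ positivePairs D C, p q.1 q.2 = q.1 :: (p q.1 q.2).tail := by
    intro q hq
    obtain ⟨t, ht⟩ := (hp q hq).1.exists_cons
    rw [ht, List.tail_cons]
  have hne : ∀ q ∈ positivePairs D C, q.1 ≠ q.2 := fun q hq =>
    (mem_positivePairs.1 hq).1
  have hb0 : ∀ q ∈ positivePairs D C, 0 < mlCoeff D C q.1 q.2 := fun q hq =>
    (mem_positivePairs.1 hq).2
  have hb : ∀ q ∈ positivePairs D C,
      mlCoeff D C q.1 q.2 = pathWeight C (q.1 :: (p q.1 q.2).tail) := by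
    intro q hq
    rw [← hcons q hq, (hp q hq).2]
  have hp' : ∀ q ∈ positivePairs D C, IsCriticalPath D C q.1 q.2 (q.1 :: (p q.1 q.2).tail) := by
    intro q hq
    rw [← hcons q hq]
    exact hp q hq
  have hS : ∀ q ∈ positivePairs D C, (p q.1 q.2).tail.toFinset.Nonempty := fun q hq =>
    ⟨q.2, List.mem_toFinset.2 ((hp' q hq).1.last_mem_tail (hne q hq))⟩
  set c : V → V → ℝ := fun j i => P.real {ω | maskedRatio D C Z ε (p j i).tail.toFinset j i ω ≤
    pathWeight C (j :: (p j i).tail)} with hc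
  have hc0 : ∀ q ∈ positivePairs D C, 0 < c q.1 q.2 := fun q hq =>
    hU.real_maskedRatio_le_pos hα hC (hp' q hq)
  refine ⟨c, fun q hq => ?_, ?_⟩
  · intro j i b S
    have h1 := hU.isEquivalent_ratio hα hC (hp' q hq) (hS q hq)
    have h2 := hU.isEquivalent_prod hα hC (hp' q hq) (hS q hq)
    rw [← hb q hq] at h1 h2
    refine ⟨⟨hc0 q hq, hU.real_maskedRatio_le_lt_one (hne q hq) (hp' q hq).1⟩,
      h1.trans h2.symm, ?_⟩
    simp only [hc]
    rw [← hb q hq]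
    exact h1
  · intro a ha Ω' _ P' _ X hX x hx
    set R := positivePairs D C
    have han : ∀ q ∈ R, Tendsto (a q.1 q.2) atTop (𝓝[>] 0) := fun q hq =>
      (hU.tendsto_normalization hα (hS q hq) (ha q hq)).1
    set u : V × V → ℕ → ℝ := fun q n => mlCoeff D C q.1 q.2 * (1 + a q.1 q.2 n * x q.1 q.2)
      with hu
    set lam : V × V → ℝ := fun q =>
      c q.1 q.2 * x q.1 q.2 ^ (((p q.1 q.2).tail.toFinset.card : ℝ) * α) with hlam
    -- Measurability of U is read off from the identical distribution of the sample.
    have hUm : AEMeasurable (fun ω i => U i ω) P := (hX.ident 0).aemeasurable_snd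
    have hsingle : ∀ q ∈ R, Tendsto (fun n : ℕ => n * P.real {ω | U q.2 ω / U q.1 ω ≤ u q n})
        atTop (𝓝 (lam q)) := by
      intro q hq
      have := hU.tendsto_nat_mul_ratio hα hC (hp' q hq) (hS q hq) (ha q hq) (hx q hq)
      rw [← hb q hq] at this
      simp only [hlam, hc]
      rw [← hb q hq]
      exact this
    have hpair : ∀ q ∈ R, ∀ r ∈ R, q ≠ r → Tendsto (fun n : ℕ => n * P.real
        ({ω | U q.2 ω / U q.1 ω ≤ u q n} ∩ {ω | U r.2 ω / U r.1 ω ≤ u r n})) atTop (𝓝 0) := by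
      intro q hq r hr hqr
      have := hU.tendsto_pair (hp' q hq).1 (hp' r hr).1 (hne q hq) (hne r hr) hqr
        (hU.tendsto_nat_mul_prod hα (hS q hq) (ha q hq) (hx q hq))
        (hU.tendsto_nat_mul_prod hα (hS r hr) (ha r hr) (hx r hr))
        (tendsto_one_add_mul (han q hq) (hx q hq)) (tendsto_one_add_mul (han r hr) (hx r hr))
      rw [← hb q hq, ← hb r hr] at this
      exact this
    have hT : ∀ T ⊆ R, Tendsto (fun n => P'.real {ω | ∀ q ∈ T,
        ω ∉ {ω | ∃ k : Fin n, X k ω q.2 / X k ω q.1 ≤ u q n}}) atTop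
        (𝓝 (∏ q ∈ T, Real.exp (-lam q))) := by
      intro T hTR
      have h1 := tendsto_nat_mul_real_biUnion (P := P) T
        (fun q n => {ω | U q.2 ω / U q.1 ω ≤ u q n}) lam
        (fun q _ n => nullMeasurableSet_ratio_le hUm _ _ _) (fun q hq => hsingle q (hTR hq))
        fun q hq r hr => hpair q (hTR hq) r (hTR hr)
      -- The probability that n independent observations all avoid the union is (1 - P(union))^n,
      -- where n P(union) tends to the sum of the rates.
      have h2 := Real.tendsto_one_add_pow_exp_of_tendsto (h1.neg.congr fun n =>
        (mul_neg _ _).symm)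
      rw [← Real.exp_sum, Finset.sum_neg_distrib]
      refine h2.congr fun n => ?_
      rw [hX.real_forall_lt T (fun q => u q n) n, sub_eq_add_neg]
    have hlim := tendsto_real_forall_mem (P := P') R
      (fun q n => {ω | ∃ k : Fin n, X k ω q.2 / X k ω q.1 ≤ u q n})
      (fun q => Real.exp (-lam q)) (fun q _ n => ?_) hT
    · have hprod : ∏ q ∈ R, (1 - Real.exp (-lam q)) = ∏ q ∈ R,
          weibullCDF (pathLength (p q.1 q.2) * α)
            (c q.1 q.2 ^ (-(1 / (pathLength (p q.1 q.2) * α)))) (x q.1 q.2) := by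
        refine Finset.prod_congr rfl fun q hq => ?_
        have hκ : 0 < (pathLength (p q.1 q.2) : ℝ) * α :=
          mul_pos (Nat.cast_pos.2 (Finset.card_pos.2 (hS q hq))) (hα q.1).1
        rw [weibullCDF_eq hκ (hc0 q hq) (hx q hq)]
        rfl
      rw [← hprod]
      refine hlim.congr' ?_
      -- The normalising sequences are positive only eventually; from then on dividing by them
      -- preserves the inequality.
      have hpos : ∀ᶠ n in atTop, ∀ q ∈ R, 0 < a q.1 q.2 n :=
        (Finset.eventually_all R).2 fun q hq => (han q hq).eventually self_mem_nhdsWithin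
      filter_upwards [hpos, eventually_ne_atTop 0] with n hn hn0
      congr 1
      ext ω
      refine forall₂_congr fun q hq => ?_
      rw [one_div_mul_sub_le_iff (hn q hq) (hb0 q hq), minRatio_le_iff hn0]
    · have : {ω | ∃ k : Fin n, X k ω q.2 / X k ω q.1 ≤ u q n} =
          ⋃ k : Fin n, {ω | X k ω q.2 / X k ω q.1 ≤ u q n} := by
        ext ω; simp
      rw [this]
      exact .iUnion fun k => nullMeasurableSet_ratio_le (Y := fun i ω => X k ω i)
        (hX.ident k).aemeasurable_fst _ _ _
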